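/- **Conventions.** Let $(X,\mathrm{dist})$ be a metric space, $k,z\ge 1$ integers, $0<\varepsilon<1/3$, and $P$ a finite family of $n=|P|$ points of $X$ (in particular, any finite set). For $p\in X$ and a tuple $S$ of centers, $\mathrm{cost}(p,S)=\min_{s\in S}\mathrm{dist}(p,s)^z$ and $\mathrm{cost}(P,S)=\sum_{p\in P}\mathrm{cost}(p,S)$. For a weighted collection $\Omega$ of points, $\mathrm{cost}(\Omega,S)=\sum_{(p,w)\in\Omega}w\,\mathrm{cost}(p,S)$. Given a tuple $\mathcal A$ of centers, every $p\in P$ is assigned to one of its nearest centers in $\mathcal A$, and the points assigned to the same center form a cluster. A finite set $\mathbb C\subseteq X$ is an *$\mathcal A$-approximate centroid set* for $(k,z)$-clustering on $P$ if for every $S\in X^k$ there is $\tilde S\in\mathbb C^k$ such that, for every $p\in P$ with $\mathrm{cost}(p,S)\le(8z/\varepsilon)^z\,\mathrm{cost}(p,\mathcal A)$ or $\mathrm{cost}(p,\tilde S)\le(8z/\varepsilon)^z\,\mathrm{cost}(p,\mathcal A)$, $$|\mathrm{cost}(p,S)-\mathrm{cost}(p,\tilde S)|\le\frac{\varepsilon}{z\log(z/\varepsilon)}\bigl(\mathrm{cost}(p,S)+\mathrm{cost}(p,\mathcal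 A)\bigr).$$ **Algorithm.** The input is $P$, a solution $\mathcal A$ together with the assignment of the points to the centers and a number $\Delta_C$ for each cluster, and an oracle for the distances from $P$ to $\mathcal A$. For each cluster $C$ with center $c$ and each integer $j$, the ring $R_{C,j}$ consists of the $p\in C$ with $(\varepsilon/z)^2\Delta_C2^j\le\mathrm{dist}(p,c)<(\varepsilon/z)^2\Delta_C2^{j+1}$ (if $\Delta_C=0$, all points of $C$ form one ring). From every ring $R$ with $|R|\le\delta$ put all points into $\Omega$ with weight $1$; from every other nonempty ring put $\delta$ independent uniformly random points of $R$ into $\Omega$, each with weight $|R|/\delta$. Elementary steps are real arithmetic, comparisons, $\log_2$, rounding down, memory accesses, distance queries and drawing a uniformly random index. **Lemma.** There are an absolute constant $K_0$ and, for every $a\in\mathbb N$, a constant $K$ depending only on $a$ such that the following holds. Let $\mathcal A$ be a tuple of at most $a\,k$ centers such that, for every cluster $C$ (with center $c$), there is a number $\Delta_C$ with $(\varepsilon/z)^2\Delta_C\le\mathrm{dist}(p,c)\le(z/\varepsilon)^2\Delta_C$ for all $p\in C$; use these numbers $\Delta_C$ in the algorithm. Let $\mathbb C$ be an $\mathcal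 A$-approximate centroid set for $(k,z)$-clustering on $P$, let $0<\pi<1$, and exclude the degenerate case in which $k=1$, $|\mathbb C|\le 1$ and $\pi>1/2$. Put $T=k\log k+k\log|\mathbb C|+\log(1/\pi)$ (with $k\log|\mathbb C|$ read as $0$ if $\mathbb C=\emptyset$) and run the algorithm with $$\delta=\Bigl\lceil K_0\,2^{K_0z}\,\frac{\log^2(1/\varepsilon)}{\varepsilon^2}\,T\Bigr\rceil.$$ Then the algorithm always executes at most $K_0(n+1)$ elementary steps, and always outputs a collection $\Omega$ of positively weighted points of $P$ whose size (with multiplicity) satisfies $$|\Omega|\le K\,k\,2^{Kz}\,\frac{\log^3(1/\varepsilon)}{\varepsilon^2}\bigl(k\log k+k\log|\mathbb C|+\log(1/\pi)\bigr).$$ With probability at least $1-\pi$, the following holds simultaneously for all $S\in X^k$: $$|\mathrm{cost}(P,S)-\mathrm{cost}(\Omega,S)|\le K_0\,\varepsilon\,\bigl(\mathrm{cost}(P,S)+\mathrm{cost}(P,\mathcal A)\bigr),$$ and, for every $\alpha$ such that $\mathcal A$ is an $\alpha$-approximation (that is, $\mathrm{cost}(P,\mathcal A)\le\alpha\,\mathrm{cost}(P,S')$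 for all $S'\in X^k$), $$|\mathrm{cost}(P,S)-\mathrm{cost}(\Omega,S)|\le K_0(1+\alpha)\,\varepsilon\,\mathrm{cost}(P,S).$$ In particular, if $\mathcal A$ is a constant-factor approximation, the cost of every $k$-center solution is preserved up to a factor $1\pm O(\varepsilon)$. -/

import Mathlib

namespace RingCoreset

/-! ### Clustering costs -/

section Costs

variable {X : Type*} [MetricSpace X]

/-- The cost `dist(p, S)^z` of a point `p` for the centers `S 0, …, S (k-1)`. -/
noncomputable def cost {k : ℕ} (z : ℕ) (p : X) (S : Fin k → X) : ℝ :=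
  (⨅ j, dist p (S j)) ^ z

/-- `cost(P, S) = ∑_{p ∈ P} cost(p, S)`, the points of `P` being listed with multiplicity. -/
noncomputable def totalCost {n k : ℕ} (z : ℕ) (P : Fin n → X) (S : Fin k → X) : ℝ :=
  ∑ i, cost z (P i) S

/-- `cost(Ω, S) = ∑_{(p, w) ∈ Ω} w · cost(p, S)` for a weighted collection `Ω` of points of `P`;
a point of `P` is given by its index. -/
noncomputable def weightedCost {n k : ℕ} (z : ℕ) (P : Fin n → X) (Ω : List (Fin n × ℝ))
    (S : Fin k → X) : ℝ :=
  (Ω.map fun e => e.2 * cost z (P e.1) S).sum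

/-- `σ` assigns to every point of `P` a nearest center of `A`; its fibres are the clusters induced
by `A` (ties are broken by `σ`). -/
def IsNearestAssignment {n m : ℕ} (P : Fin n → X) (A : Fin m → X) (σ : Fin n → Fin m) : Prop :=
  ∀ i j, dist (P i) (A (σ i)) ≤ dist (P i) (A j)

/-- The points of each cluster are at distance between `(ε/z)² Δ_c` and `(z/ε)² Δ_c` of the
center `c` of the cluster. -/
def ClustersInRange {n m : ℕ} (z : ℕ) (ε : ℝ) (P : Fin n → X) (A : Fin m → X)
    (σ : Fin n → Fin m) (Δ : Fin m → ℝ) : Prop :=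
  ∀ i, (ε / z) ^ 2 * Δ (σ i) ≤ dist (P i) (A (σ i)) ∧
    dist (P i) (A (σ i)) ≤ (z / ε) ^ 2 * Δ (σ i)

/-- `C` is an `A`-approximate centroid set for `(k, z)`-clustering on `P`, with precision `ε`. -/
def IsApproxCentroidSet {n m : ℕ} (k z : ℕ) (ε : ℝ) (P : Fin n → X) (A : Fin m → X)
    (C : Finset X) : Prop :=
  ∀ S : Fin k → X, ∃ S' : Fin k → X, (∀ j, S' j ∈ C) ∧
    ∀ i, (cost z (P i) S ≤ (8 * z / ε) ^ z * cost z (P i) A ∨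
        cost z (P i) S' ≤ (8 * z / ε) ^ z * cost z (P i) A) →
      |cost z (P i) S - cost z (P i) S'| ≤
        ε / (z * Real.log (z / ε)) * (cost z (P i) S + cost z (P i) A)

/-- `A` is an `α`-approximation for `(k, z)`-clustering on `P`. -/
def IsApproxSolution {n m : ℕ} (k z : ℕ) (α : ℝ) (P : Fin n → X) (A : Fin m → X) : Prop :=
  ∀ S : Fin k → X, totalCost z P A ≤ α * totalCost z P S

end Costs

/-! ### Randomised computations with a step count -/

/-- A randomised computation: a law on pairs (result, number of executed elementary steps). -/
structure RandM (α : Type) : Type where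
  law : PMF (α × ℕ)

/-- Sequential composition adds the numbers of steps; a `pure` computation only names a value
that is already at hand, and is free. -/
noncomputable instance : Monad RandM where
  pure a := ⟨PMF.pure (a, 0)⟩
  bind x f := ⟨PMF.bind x.law fun r => PMF.map (fun r' => (r'.1, r.2 + r'.2)) (f r.1).law⟩

/-- One elementary operation with result `a`: reading an input value (cluster of a point, distance
of a point to a center), one operation on reals or integers, one comparison, one access to memory
(read a cell, write a cell, size of an array, append one element). -/
noncomputable def step {α : Type} (a : α) : RandM α := ⟨PMF.pure (a, 1)⟩

/-- Draw a uniformly random element of `{0, …, s-1}`, in one step. -/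
noncomputable def uniformIndex (s : ℕ) [NeZero s] : RandM (Fin s) :=
  ⟨PMF.map (fun r => (r, 1)) (PMF.uniformOfFintype (Fin s))⟩

/-! ### Uniform sampling from rings -/

/-- The memory of the algorithm: an array of point indices for every ring (a ring is addressed by
its cluster and its level), and the list of the rings that are not empty. -/
structure Rings (n m : ℕ) where
  bucket : Fin m × ℤ → Array (Fin n)
  keys : List (Fin m × ℤ)

/-- The ring of the point `i`: the cluster `c` of `i` and the level `j` with
`(ε/z)² Δ_c 2^j ≤ d(i, c) < (ε/z)² Δ_c 2^(j+1)`. Here `d` is the distance oracle. -/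
noncomputable def ringKey {n m : ℕ} (z : ℕ) (ε : ℝ) (σ : Fin n → Fin m) (d : Fin n → Fin m → ℝ)
    (Δ : Fin m → ℝ) (i : Fin n) : RandM (Fin m × ℤ) := do
  let c ← step (σ i)
  let dist ← step (d i c)
  let Δc ← step (Δ c)
  let r ← step (ε / z)
  let r2 ← step (r * r)
  let base ← step (r2 * Δc)
  let q ← step (dist / base)
  let l ← step (Real.logb 2 q)
  let j ← step ⌊l⌋
  pure (c, j)

/-- Append the point `i` to the array of the ring `key`. -/
noncomputable def insertPoint {n m : ℕ} (T : Rings n m) (key : Fin m × ℤ) (i : Fin n) :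
    RandM (Rings n m) := do
  let b ← step (T.bucket key)
  let s ← step b.size
  let isNew ← step (decide (s = 0))
  let keys ← if isNew then step (key :: T.keys) else pure T.keys
  let bucket ← step (Function.update T.bucket key (b.push i))
  pure ⟨bucket, keys⟩

/-- Distribute the listed points over their rings, starting from the memory `T`. -/
noncomputable def buildRings {n m : ℕ} (z : ℕ) (ε : ℝ) (σ : Fin n → Fin m)
    (d : Fin n → Fin m → ℝ) (Δ : Fin m → ℝ) : List (Fin n) → Rings n m → RandM (Rings n m)
  | [], T => step T
  | i :: l, T => do
    let i ← step i
    let key ← ringKey z ε σ d Δ i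
    let T' ← insertPoint T key i
    buildRings z ε σ d Δ l T'

/-- Append all the listed points, with weight `1`, to the output. -/
noncomputable def emitAll {n : ℕ} :
    List (Fin n) → List (Fin n × ℝ) → RandM (List (Fin n × ℝ))
  | [], out => step out
  | i :: l, out => do
    let i ← step i
    let out' ← step ((i, 1) :: out)
    emitAll l out'

/-- Draw `t` points of the array `b`, uniformly and independently, and append them with weight `w`
to the output. -/
noncomputable def emitSamples {n : ℕ} (b : Array (Fin n)) [NeZero b.size] (w : ℝ) :
    ℕ → List (Fin n × ℝ) → RandM (List (Fin n × ℝ))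
  | 0, out => step out
  | t + 1, out => do
    let r ← uniformIndex b.size
    let i ← step b[r]
    let out' ← step ((i, w) :: out)
    emitSamples b w t out'

/-- Treat one ring `b`: if it has at most `δ` points, keep them all; otherwise draw `δ` points
uniformly at random, each with weight `|b| / δ`. Two steps are charged for reading `|b|` and
comparing it with `δ`. -/
noncomputable def sampleRing {n : ℕ} (δ : ℕ) (b : Array (Fin n)) (out : List (Fin n × ℝ)) :
    RandM (List (Fin n × ℝ)) := do
  let s ← step b.size
  step ()
  if h : b.size ≤ δ then
    emitAll b.toList out
  else
    have : NeZero b.size := ⟨by omega⟩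
    let w ← step ((s : ℝ) / δ)
    emitSamples b w δ out

/-- Treat the listed rings one after the other. -/
noncomputable def sampleRings {n m : ℕ} (δ : ℕ) (T : Rings n m) :
    List (Fin m × ℤ) → List (Fin n × ℝ) → RandM (List (Fin n × ℝ))
  | [], out => step out
  | key :: l, out => do
    let b ← step (T.bucket key)
    let out' ← sampleRing δ b out
    sampleRings δ T l out'

/-- The whole algorithm. Its input is the number `n` of points, the solution `A` in the form of the
assignment `σ` of the points to the centers, the distance oracle `d` and the scales `Δ`, and the
number `δ` of samples per ring. Its output is a list of weighted points. -/
noncomputable def ringSampling {n m : ℕ} (z : ℕ) (ε : ℝ) (σ : Fin n → Fin m)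
    (d : Fin n → Fin m → ℝ) (Δ : Fin m → ℝ) (δ : ℕ) : RandM (List (Fin n × ℝ)) := do
  let T₀ ← step (⟨fun _ => #[], []⟩ : Rings n m)
  let T ← buildRings z ε σ d Δ (List.finRange n) T₀
  sampleRings δ T T.keys []

/-! ### The bounds -/

/-- `k log k + k log |C| + log (1/π)`, with `N = |C|`. -/
noncomputable def entropyTerm (k N : ℕ) (π : ℝ) : ℝ :=
  k * Real.log k + k * Real.log N + Real.log (1 / π)

/-- The number of samples per ring,
`⌈K · 2^(K z) · log²(1/ε) / ε² · (k log k + k log |C| + log (1/π))⌉`. -/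
noncomputable def samplesPerRing (K k z N : ℕ) (ε π : ℝ) : ℕ :=
  ⌈K * 2 ^ (K * z) * (Real.log (1 / ε) ^ 2 / ε ^ 2) * entropyTerm k N π⌉₊

/-- `K · k · 2^(K z) · log³(1/ε) / ε² · (k log k + k log |C| + log (1/π))`. -/
noncomputable def sizeBound (K k z N : ℕ) (ε π : ℝ) : ℝ :=
  K * (k * 2 ^ (K * z) * (Real.log (1 / ε) ^ 3 / ε ^ 2) * entropyTerm k N π)

/-- The law of (output, number of steps) when the algorithm is run on the points `P` with the
solution `A` and `samplesPerRing K k z N ε π` samples per ring. -/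
noncomputable def coresetLaw {X : Type*} [MetricSpace X] {n m : ℕ} (K k z N : ℕ) (ε π : ℝ)
    (P : Fin n → X) (A : Fin m → X) (σ : Fin n → Fin m) (Δ : Fin m → ℝ) :
    PMF (List (Fin n × ℝ) × ℕ) :=
  (ringSampling z ε σ (fun i c => dist (P i) (A c)) Δ (samplesPerRing K k z N ε π)).law

end RingCoreset

namespace RingCoreset

open scoped ENNReal

/-! ### Calculus of randomised computations -/

/-! Fix `S` and the tuple `S'` from the centroid set that approximates it. Call a ring near if every
point `p` of it satisfies `cost(p, S') ≤ (8z/ε)^z cost(p, A)`, and far otherwise. Two points of a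
ring are at distance at most three times the distance of either to `A`. Hence `cost(·, S)` is
constant up to a factor `1 ± 2ε` on a far ring (`exists_constant_of_far`). The sampled weights of a
ring add up to exactly its size (`ringSampling_spec`), so far rings contribute a small error with
certainty. On near rings the centroid property replaces `S` by `S'`.

What remains random are the functions equal to `cost(·, S')` on the near rings of `S'` and to `0`
elsewhere, together with `cost(·, A)`: at most `|C|^k + 1` functions, independent of `S`. On a ring
`R` the maximum of such a `g` is at most `8^z (g(p) + cost(p, A))` for every `p` in `R`
(`cost_le_of_ring`). Hoeffding's lemma gives the variance proxy `∑_R (|R| max_R g)² / δ`, which is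
at most `(∑_R |R| max_R g)² / δ` and so does not grow with the number of rings
(`expect_ringSampling_le`). Markov's inequality and a union bound follow (`deviation_bound`,
`union_bound_le`), and `weightedSum_sub_sum_le` assembles the error.

The size bound counts the `O(log(z/ε))` levels of each cluster (`card_rings_le`); size, weights and
running time hold on the whole support of the law. -/

theorem mem_support_bind {α β : Type} (x : RandM α) (f : α → RandM β) (r : β × ℕ) :
    r ∈ (x >>= f).law.support ↔
      ∃ s ∈ x.law.support, ∃ t ∈ (f s.1).law.support, r = (t.1, s.2 + t.2) := by
  change r ∈ (PMF.bind x.law fun r => PMF.map (fun r' => (r'.1, r.2 + r'.2)) (f r.1).law).support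
    ↔ _
  simp only [PMF.mem_support_bind_iff, PMF.mem_support_map_iff, eq_comm]

theorem mem_support_step {α : Type} (a : α) (r : α × ℕ) :
    r ∈ (step a).law.support ↔ r = (a, 1) := by
  simp [step]

theorem mem_support_pure {α : Type} (a : α) (r : α × ℕ) :
    r ∈ (pure a : RandM α).law.support ↔ r = (a, 0) := by
  change r ∈ (PMF.pure (a, 0)).support ↔ _
  simp

theorem mem_support_step_bind {α β : Type} (a : α) (f : α → RandM β) (r : β × ℕ) :
    r ∈ (step a >>= f).law.support ↔ ∃ t ∈ (f a).law.support, r = (t.1, 1 + t.2) := by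
  rw [mem_support_bind]
  simp only [mem_support_step]
  exact ⟨by rintro ⟨_, rfl, h⟩; exact h, fun h => ⟨_, rfl, h⟩⟩

theorem snd_of_mem_support_uniformIndex {s : ℕ} [NeZero s] {r : Fin s × ℕ}
    (hr : r ∈ (uniformIndex s).law.support) : r.2 = 1 := by
  simp only [uniformIndex, PMF.mem_support_map_iff] at hr
  obtain ⟨a, -, rfl⟩ := hr
  rfl

/-- Expected value of a function of the result of a randomised computation. -/
noncomputable def RandM.expect {α : Type} (x : RandM α) (F : α → ℝ≥0∞) : ℝ≥0∞ :=
  ∑' r, x.law r * F r.1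

theorem tsum_bind_mul {α β : Type} (p : PMF α) (q : α → PMF β) (F : β → ℝ≥0∞) :
    ∑' b, p.bind q b * F b = ∑' a, p a * ∑' b, q a b * F b := by
  simp only [PMF.bind_apply, ← ENNReal.tsum_mul_right, ← ENNReal.tsum_mul_left]
  rw [ENNReal.tsum_comm]
  simp only [mul_assoc]

theorem tsum_pure_mul {α : Type} (a : α) (F : α → ℝ≥0∞) :
    ∑' b, PMF.pure a b * F b = F a := by
  rw [tsum_eq_single a]
  · simp
  · intro b hb
    simp [PMF.pure_apply_of_ne _ _ hb]

theorem tsum_map_mul {α β : Type} (h : α → β) (p : PMF α) (F : β → ℝ≥0∞) :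
    ∑' b, p.map h b * F b = ∑' a, p a * F (h a) := by
  rw [PMF.map, tsum_bind_mul]
  simp only [Function.comp_apply, tsum_pure_mul]

/-- Values in `ℝ≥0∞` make the exchange of sums unconditional. Independence of the samples enters the
proof only through this rule. -/
theorem expect_bind {α β : Type} (x : RandM α) (f : α → RandM β) (F : β → ℝ≥0∞) :
    (x >>= f).expect F = x.expect fun a => (f a).expect F := by
  change ∑' r, (PMF.bind x.law fun r => PMF.map (fun r' => (r'.1, r.2 + r'.2)) (f r.1).law) r *
    F r.1 = _
  rw [tsum_bind_mul _ _ fun r : β × ℕ => F r.1]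
  simp only [tsum_map_mul _ _ fun r : β × ℕ => F r.1]
  rfl

theorem expect_step {α : Type} (a : α) (F : α → ℝ≥0∞) : (step a).expect F = F a :=
  tsum_pure_mul (a, 1) fun r : α × ℕ => F r.1

theorem expect_pure {α : Type} (a : α) (F : α → ℝ≥0∞) : (pure a : RandM α).expect F = F a :=
  tsum_pure_mul (a, 0) fun r : α × ℕ => F r.1

theorem expect_const_mul {α : Type} (x : RandM α) (a : ℝ≥0∞) (F : α → ℝ≥0∞) :
    x.expect (fun o => a * F o) = a * x.expect F := by
  simp only [RandM.expect, mul_left_comm _ a, ENNReal.tsum_mul_left]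

theorem expect_uniformIndex (s : ℕ) [NeZero s] (F : Fin s → ℝ≥0∞) :
    (uniformIndex s).expect F = ∑ r, (s : ℝ≥0∞)⁻¹ * F r := by
  change ∑' r, (PMF.map (fun r => (r, 1)) (PMF.uniformOfFintype (Fin s))) r * F r.1 = _
  rw [tsum_map_mul _ _ fun r : Fin s × ℕ => F r.1]
  simp

theorem expect_mono {α : Type} (x : RandM α) {F G : α → ℝ≥0∞} (h : ∀ a, F a ≤ G a) :
    x.expect F ≤ x.expect G :=
  ENNReal.tsum_le_tsum fun r => mul_le_mul_right (h r.1) _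

/-! ### Hoeffding's lemma for finite averages -/

/-- A variable with values in `[-b, b]` is sub-Gaussian about its mean with variance proxy `b ^ 2`,
the square of half the length of the interval. -/
theorem average_exp_le {s : ℕ} [NeZero s] (y : Fin s → ℝ) {b : ℝ} (hy : ∀ r, |y r| ≤ b) (t : ℝ) :
    ∑ r, (s : ℝ)⁻¹ * Real.exp (t * y r) ≤
      Real.exp (t * ((s : ℝ)⁻¹ * ∑ r, y r) + t ^ 2 * b ^ 2 / 2) := by
  have hb : 0 ≤ b := (abs_nonneg _).trans (hy 0)
  set μ := (PMF.uniformOfFintype (Fin s)).toMeasure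
  have key := (ProbabilityTheory.hasSubgaussianMGF_of_mem_Icc (μ := μ) (X := y) (a := -b) (b := b)
    (measurable_of_finite y).aemeasurable (.of_forall fun r => abs_le.1 (hy r))).mgf_le t
  simp only [ProbabilityTheory.mgf, μ, PMF.integral_eq_sum] at key
  have hc : (((‖b - -b‖₊ / 2) ^ 2 : NNReal) : ℝ) = b ^ 2 := by
    push_cast
    rw [Real.norm_eq_abs, abs_of_nonneg (by linarith)]
    ring
  rw [hc] at key
  simp only [PMF.uniformOfFintype_apply, Fintype.card_fin, smul_eq_mul, ENNReal.toReal_inv,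
    ENNReal.toReal_natCast] at key
  rw [← Finset.mul_sum] at key
  simp only [← Finset.mul_sum] at key ⊢
  set M := (s : ℝ)⁻¹ * ∑ r, y r
  have h2 : ∑ r, Real.exp (t * y r) = Real.exp (t * M) * ∑ r, Real.exp (t * (y r - M)) := by
    rw [Finset.mul_sum]
    refine Finset.sum_congr rfl fun r _ => ?_
    rw [← Real.exp_add]
    ring_nf
  rw [h2, Real.exp_add, mul_left_comm]
  refine mul_le_mul_of_nonneg_left (key.trans (le_of_eq ?_)) (Real.exp_nonneg _)
  ring_nf

/-! ### Sampling from one ring -/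

/-- The sum `∑ w · g(i)` over the weighted indices `(i, w)` of a list. -/
noncomputable def weightedSum {n : ℕ} (L : List (Fin n × ℝ)) (g : Fin n → ℝ) : ℝ :=
  (L.map fun e => e.2 * g e.1).sum

theorem weightedSum_cons {n : ℕ} (e : Fin n × ℝ) (L : List (Fin n × ℝ)) (g : Fin n → ℝ) :
    weightedSum (e :: L) g = e.2 * g e.1 + weightedSum L g := by
  simp [weightedSum]

theorem weightedSum_append {n : ℕ} (L L' : List (Fin n × ℝ)) (g : Fin n → ℝ) :
    weightedSum (L ++ L') g = weightedSum L g + weightedSum L' g := by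
  simp [weightedSum]

theorem emitAll_spec {n : ℕ} (l : List (Fin n)) (out : List (Fin n × ℝ))
    {r : List (Fin n × ℝ) × ℕ} (hr : r ∈ (emitAll l out).law.support) :
    ∃ L, r.1 = L ++ out ∧ (∀ e ∈ L, 0 < e.2 ∧ e.1 ∈ l) ∧ L.length = l.length ∧
      (L.map Prod.snd).sum = l.length ∧ r.2 = 2 * l.length + 1 := by
  induction l generalizing out r with
  | nil =>
    rw [emitAll, mem_support_step] at hr
    exact ⟨[], by simp [hr]⟩
  | cons i l ih =>
    rw [emitAll, mem_support_step_bind] at hr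
    obtain ⟨t, ht, rfl⟩ := hr
    rw [mem_support_step_bind] at ht
    obtain ⟨t, ht, rfl⟩ := ht
    obtain ⟨L, h1, h2, h3, h4, h5⟩ := ih _ ht
    refine ⟨L ++ [(i, 1)], by simp [h1], ?_, by simp [h3], by simp [h4], ?_⟩
    · intro e he
      rcases List.mem_append.1 he with he | he
      · exact ⟨(h2 e he).1, List.mem_cons_of_mem _ (h2 e he).2⟩
      · simp only [List.mem_singleton] at he
        simp [he]
    · simp only [h5, List.length_cons]
      ring

theorem expect_emitAll {n : ℕ} (l : List (Fin n)) (out : List (Fin n × ℝ)) (g : Fin n → ℝ)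
    (F : ℝ → ℝ≥0∞) :
    (emitAll l out).expect (fun o => F (weightedSum o g)) =
      F (weightedSum out g + (l.map g).sum) := by
  induction l generalizing out with
  | nil => simp [emitAll, expect_step]
  | cons i l ih =>
    rw [emitAll, expect_bind, expect_step, expect_bind, expect_step, ih, weightedSum_cons]
    congr 1
    simp
    ring

theorem emitSamples_spec {n : ℕ} (b : Array (Fin n)) [NeZero b.size] {w : ℝ} (hw : 0 < w)
    (t : ℕ) (out : List (Fin n × ℝ)) {r : List (Fin n × ℝ) × ℕ}
    (hr : r ∈ (emitSamples b w t out).law.support) :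
    ∃ L, r.1 = L ++ out ∧ (∀ e ∈ L, 0 < e.2 ∧ e.1 ∈ b.toList) ∧ L.length = t ∧
      (L.map Prod.snd).sum = t * w ∧ r.2 = 3 * t + 1 := by
  induction t generalizing out r with
  | zero =>
    rw [emitSamples, mem_support_step] at hr
    exact ⟨[], by simp [hr]⟩
  | succ t ih =>
    rw [emitSamples, mem_support_bind] at hr
    obtain ⟨u, hu, t₁, ht, rfl⟩ := hr
    rw [mem_support_step_bind] at ht
    obtain ⟨t₂, ht, rfl⟩ := ht
    rw [mem_support_step_bind] at ht
    obtain ⟨t₃, ht, rfl⟩ := ht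
    obtain ⟨L, h1, h2, h3, h4, h5⟩ := ih _ ht
    refine ⟨L ++ [(b[u.1], w)], by simp [h1], ?_, by simp [h3], ?_, ?_⟩
    · intro e he
      rcases List.mem_append.1 he with he | he
      · exact h2 e he
      · simp only [List.mem_singleton] at he
        simp [he, hw]
    · simp only [List.map_append, List.sum_append, h4, List.map_cons, List.map_nil,
        List.sum_singleton]
      push_cast
      ring
    · simp only [h5, snd_of_mem_support_uniformIndex hu]
      ring

theorem sum_array_eq {n : ℕ} (b : Array (Fin n)) (f : Fin n → ℝ) :
    ∑ r : Fin b.size, f b[r] = (b.toList.map f).sum := by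
  rw [← List.sum_ofFn]
  congr 1
  apply List.ext_getElem <;> simp

/-- Each draw contributes one factor, bounded by Hoeffding's lemma with parameter `t * w`. -/
theorem expect_emitSamples_le {n : ℕ} (b : Array (Fin n)) [NeZero b.size] (w c t : ℝ) (m : ℕ)
    (out : List (Fin n × ℝ)) (g : Fin n → ℝ) (hg : ∀ i ∈ b.toList, |g i| ≤ c) :
    (emitSamples b w m out).expect (fun o => ENNReal.ofReal (Real.exp (t * weightedSum o g))) ≤
      ENNReal.ofReal (Real.exp (t * weightedSum out g +
        m * ((t * w) * ((b.size : ℝ)⁻¹ * (b.toList.map g).sum) + (t * w) ^ 2 * c ^ 2 / 2))) := by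
  induction m generalizing out with
  | zero => simp [emitSamples, expect_step]
  | succ m ih =>
    rw [emitSamples, expect_bind, expect_uniformIndex]
    set Q := (t * w) * ((b.size : ℝ)⁻¹ * (b.toList.map g).sum) + (t * w) ^ 2 * c ^ 2 / 2
    have h1 : ∀ r : Fin b.size,
        ((b.size : ℝ≥0∞)⁻¹ * (step b[r] >>= fun i => step ((i, w) :: out) >>= fun out' =>
          emitSamples b w m out').expect
            (fun o => ENNReal.ofReal (Real.exp (t * weightedSum o g)))) ≤
        ENNReal.ofReal (Real.exp (t * weightedSum out g + m * Q) *
          ((b.size : ℝ)⁻¹ * Real.exp ((t * w) * g b[r]))) := by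
      intro r
      rw [expect_bind, expect_step, expect_bind, expect_step]
      have hs : (0 : ℝ) < b.size := by exact_mod_cast Nat.pos_of_ne_zero (NeZero.ne b.size)
      have h2 : (b.size : ℝ≥0∞)⁻¹ = ENNReal.ofReal ((b.size : ℝ)⁻¹) := by
        rw [ENNReal.ofReal_inv_of_pos hs, ENNReal.ofReal_natCast]
      refine (mul_le_mul_right (ih _) _).trans (le_of_eq ?_)
      rw [h2, ← ENNReal.ofReal_mul (by positivity), weightedSum_cons]
      congr 1
      rw [mul_left_comm, ← Real.exp_add]
      congr 2
      simp only
      ring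
    refine (Finset.sum_le_sum fun r _ => h1 r).trans ?_
    rw [← ENNReal.ofReal_sum_of_nonneg fun r _ => by positivity, ← Finset.mul_sum]
    refine ENNReal.ofReal_le_ofReal ?_
    have h3 := average_exp_le (fun r : Fin b.size => g b[r]) (b := c)
      (fun r => hg _ (by simp)) (t * w)
    rw [sum_array_eq b g] at h3
    refine (mul_le_mul_of_nonneg_left h3 (Real.exp_nonneg _)).trans (le_of_eq ?_)
    rw [← Real.exp_add]
    congr 1
    push_cast
    ring

/-- In both branches the weights add up to exactly the size of the ring: `b.size` ones, or `δ`
copies of `b.size / δ`. Therefore functions constant on rings are summed without error. -/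
theorem sampleRing_spec {n : ℕ} {δ : ℕ} (hδ : 0 < δ) (b : Array (Fin n))
    (out : List (Fin n × ℝ)) {r : List (Fin n × ℝ) × ℕ}
    (hr : r ∈ (sampleRing δ b out).law.support) :
    ∃ L, r.1 = L ++ out ∧ (∀ e ∈ L, 0 < e.2 ∧ e.1 ∈ b.toList) ∧ L.length ≤ δ ∧
      (L.map Prod.snd).sum = b.size ∧ r.2 ≤ 3 * b.size + 4 := by
  rw [sampleRing, mem_support_step_bind] at hr
  obtain ⟨t, ht, rfl⟩ := hr
  rw [mem_support_step_bind] at ht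
  obtain ⟨t, ht, rfl⟩ := ht
  split_ifs at ht with h
  · obtain ⟨L, h1, h2, h3, h4, h5⟩ := emitAll_spec _ _ ht
    simp only [Array.length_toList] at h3 h4 h5
    exact ⟨L, h1, h2, by omega, h4, by simp only [h5]; omega⟩
  · have : NeZero b.size := ⟨by omega⟩
    rw [mem_support_step_bind] at ht
    obtain ⟨t, ht, rfl⟩ := ht
    have hs : (0 : ℝ) < b.size := by
      have : 0 < b.size := by omega
      exact_mod_cast this
    have hd : (0 : ℝ) < δ := by exact_mod_cast hδ
    obtain ⟨L, h1, h2, h3, h4, h5⟩ := emitSamples_spec b (div_pos hs hd) δ out ht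
    refine ⟨L, h1, h2, h3.le, ?_, by simp only [h5]; omega⟩
    rw [h4]
    field_simp

/-- With `w = b.size / δ`, the `δ` draws contribute `δ (t w c)² / 2`, which is the quadratic term. A
ring kept in full has no deviation. -/
theorem expect_sampleRing_le {n : ℕ} {δ : ℕ} (hδ : 0 < δ) (b : Array (Fin n)) (c t : ℝ)
    (out : List (Fin n × ℝ)) (g : Fin n → ℝ) (hg : ∀ i ∈ b.toList, |g i| ≤ c) :
    (sampleRing δ b out).expect (fun o => ENNReal.ofReal (Real.exp (t * weightedSum o g))) ≤
      ENNReal.ofReal (Real.exp (t * weightedSum out g +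
        (t * (b.toList.map g).sum + t ^ 2 * (b.size * c) ^ 2 / (2 * δ)))) := by
  rw [sampleRing, expect_bind, expect_step, expect_bind, expect_step]
  have hd : (0 : ℝ) < δ := by exact_mod_cast hδ
  split_ifs with h
  · rw [expect_emitAll _ _ _ fun x => ENNReal.ofReal (Real.exp (t * x))]
    refine ENNReal.ofReal_le_ofReal (Real.exp_le_exp.2 ?_)
    have : 0 ≤ t ^ 2 * (b.size * c) ^ 2 / (2 * δ) := by positivity
    linarith
  · have : NeZero b.size := ⟨by omega⟩
    have hs : (0 : ℝ) < b.size := by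
      have : 0 < b.size := by omega
      exact_mod_cast this
    rw [expect_bind, expect_step]
    refine (expect_emitSamples_le b _ c t δ out g hg).trans (le_of_eq ?_)
    congr 3
    field_simp

/-! ### Sampling from all rings -/

theorem weightedSum_of_ring {n : ℕ} {κ : Type*} (ρ : Fin n → κ) (key : κ)
    (L : List (Fin n × ℝ)) (hL : ∀ e ∈ L, ρ e.1 = key) (h : κ → ℝ) :
    weightedSum L (fun i => h (ρ i)) = (L.map Prod.snd).sum * h key := by
  induction L with
  | nil => simp [weightedSum]
  | cons e L ih =>
    rw [weightedSum_cons, ih fun e he => hL e (List.mem_cons_of_mem _ he), hL e (by simp)]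
    simp
    ring

theorem sampleRings_spec {n m : ℕ} {δ : ℕ} (hδ : 0 < δ) (T : Rings n m)
    (ρ : Fin n → Fin m × ℤ) (hT : ∀ key, ∀ i ∈ (T.bucket key).toList, ρ i = key)
    (l : List (Fin m × ℤ)) (out : List (Fin n × ℝ)) {r : List (Fin n × ℝ) × ℕ}
    (hr : r ∈ (sampleRings δ T l out).law.support) :
    ∃ L, r.1 = L ++ out ∧ (∀ e ∈ L, 0 < e.2) ∧ L.length ≤ l.length * δ ∧
      (∀ h : Fin m × ℤ → ℝ, weightedSum L (fun i => h (ρ i)) =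
        (l.map fun key => (T.bucket key).size * h key).sum) ∧
      r.2 ≤ 3 * (l.map fun key => (T.bucket key).size).sum + 5 * l.length + 1 := by
  induction l generalizing out r with
  | nil =>
    rw [sampleRings, mem_support_step] at hr
    exact ⟨[], by simp [hr, weightedSum]⟩
  | cons key l ih =>
    rw [sampleRings, mem_support_step_bind] at hr
    obtain ⟨t, ht, rfl⟩ := hr
    rw [mem_support_bind] at ht
    obtain ⟨u, hu, v, hv, rfl⟩ := ht
    obtain ⟨L, h1, h2, h3, h4, h5⟩ := sampleRing_spec hδ _ _ hu
    obtain ⟨L', h1', h2', h3', h4', h5'⟩ := ih _ hv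
    refine ⟨L' ++ L, by simp [h1', h1], ?_, ?_, ?_, ?_⟩
    · intro e he
      rcases List.mem_append.1 he with he | he
      · exact h2' e he
      · exact (h2 e he).1
    · simp only [List.length_append, List.length_cons]
      linarith
    · intro h
      rw [weightedSum_append, h4', weightedSum_of_ring ρ key L
        (fun e he => hT key _ (h2 e he).2), h4]
      simp [add_comm]
    · simp only [List.map_cons, List.sum_cons, List.length_cons]
      omega

theorem expect_sampleRings_le {n m : ℕ} {δ : ℕ} (hδ : 0 < δ) (T : Rings n m)
    (c : Fin m × ℤ → ℝ) (t : ℝ) (g : Fin n → ℝ)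
    (hg : ∀ key, ∀ i ∈ (T.bucket key).toList, |g i| ≤ c key)
    (l : List (Fin m × ℤ)) (out : List (Fin n × ℝ)) :
    (sampleRings δ T l out).expect (fun o => ENNReal.ofReal (Real.exp (t * weightedSum o g))) ≤
      ENNReal.ofReal (Real.exp (t * weightedSum out g +
        (l.map fun key => t * ((T.bucket key).toList.map g).sum +
          t ^ 2 * ((T.bucket key).size * c key) ^ 2 / (2 * δ)).sum)) := by
  induction l generalizing out with
  | nil => simp [sampleRings, expect_step]
  | cons key l ih =>
    rw [sampleRings, expect_bind, expect_step, expect_bind]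
    refine (expect_mono _ fun o => ih o).trans ?_
    set Q := (l.map fun key => t * ((T.bucket key).toList.map g).sum +
          t ^ 2 * ((T.bucket key).size * c key) ^ 2 / (2 * δ)).sum
    have h1 : ∀ o : List (Fin n × ℝ), ENNReal.ofReal (Real.exp (t * weightedSum o g + Q)) =
        ENNReal.ofReal (Real.exp Q) * ENNReal.ofReal (Real.exp (t * weightedSum o g)) := by
      intro o
      rw [← ENNReal.ofReal_mul (Real.exp_nonneg _), ← Real.exp_add, add_comm]
    simp only [h1]
    rw [expect_const_mul]
    refine (mul_le_mul_right (expect_sampleRing_le hδ _ (c key) t out g (hg key)) _).trans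
      (le_of_eq ?_)
    rw [← ENNReal.ofReal_mul (Real.exp_nonneg _), ← Real.exp_add]
    congr 2
    simp only [List.map_cons, List.sum_cons]
    ring

/-! ### Distributing the points over the rings -/

/-- The address of the ring of a point. -/
noncomputable def ringIndex {n m : ℕ} (z : ℕ) (ε : ℝ) (σ : Fin n → Fin m)
    (d : Fin n → Fin m → ℝ) (Δ : Fin m → ℝ) (i : Fin n) : Fin m × ℤ :=
  (σ i, ⌊Real.logb 2 (d i (σ i) / (ε / z * (ε / z) * Δ (σ i)))⌋)

theorem mem_support_ringKey {n m : ℕ} (z : ℕ) (ε : ℝ) (σ : Fin n → Fin m)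
    (d : Fin n → Fin m → ℝ) (Δ : Fin m → ℝ) (i : Fin n) (r : (Fin m × ℤ) × ℕ) :
    r ∈ (ringKey z ε σ d Δ i).law.support ↔ r = (ringIndex z ε σ d Δ i, 9) := by
  simp only [ringKey, mem_support_step_bind, mem_support_pure, exists_eq_left]
  simp only [ringIndex]

theorem expect_ringKey {n m : ℕ} (z : ℕ) (ε : ℝ) (σ : Fin n → Fin m)
    (d : Fin n → Fin m → ℝ) (Δ : Fin m → ℝ) (i : Fin n) (F : Fin m × ℤ → ℝ≥0∞) :
    (ringKey z ε σ d Δ i).expect F = F (ringIndex z ε σ d Δ i) := by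
  simp only [ringKey, expect_bind, expect_step, expect_pure]
  rfl

/-- The memory after a point has been appended to a ring. -/
def Rings.insert {n m : ℕ} (T : Rings n m) (key : Fin m × ℤ) (i : Fin n) : Rings n m where
  bucket := Function.update T.bucket key ((T.bucket key).push i)
  keys := if (T.bucket key).size = 0 then key :: T.keys else T.keys

theorem insertPoint_spec {n m : ℕ} (T : Rings n m) (key : Fin m × ℤ) (i : Fin n)
    {r : Rings n m × ℕ} (hr : r ∈ (insertPoint T key i).law.support) :
    r.1 = T.insert key i ∧ r.2 ≤ 5 := by
  by_cases h : (T.bucket key).size = 0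
  · simp only [insertPoint, mem_support_step_bind, h, decide_true, if_true, mem_support_pure,
      exists_eq_left] at hr
    subst hr
    simp [Rings.insert, h]
  · simp only [insertPoint, mem_support_bind, mem_support_step, h, decide_false, mem_support_pure,
      exists_eq_left, Bool.false_eq_true, if_false] at hr
    subst hr
    simp [Rings.insert, h]

theorem expect_insertPoint {n m : ℕ} (T : Rings n m) (key : Fin m × ℤ) (i : Fin n)
    (F : Rings n m → ℝ≥0∞) : (insertPoint T key i).expect F = F (T.insert key i) := by
  by_cases h : (T.bucket key).size = 0
  · simp only [insertPoint, expect_bind, expect_step, h, decide_true, if_true, expect_pure,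
      Rings.insert]
  · simp only [insertPoint, expect_bind, expect_step, h, decide_false, Bool.false_eq_true,
      if_false, expect_pure, Rings.insert]

/-- The memory after the listed points have been appended to their rings. -/
def Rings.insertAll {n m : ℕ} (ρ : Fin n → Fin m × ℤ) : List (Fin n) → Rings n m → Rings n m
  | [], T => T
  | i :: l, T => Rings.insertAll ρ l (T.insert (ρ i) i)

theorem buildRings_spec {n m : ℕ} (z : ℕ) (ε : ℝ) (σ : Fin n → Fin m)
    (d : Fin n → Fin m → ℝ) (Δ : Fin m → ℝ) (l : List (Fin n)) (T : Rings n m)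
    {r : Rings n m × ℕ} (hr : r ∈ (buildRings z ε σ d Δ l T).law.support) :
    r.1 = T.insertAll (ringIndex z ε σ d Δ) l ∧ r.2 ≤ 15 * l.length + 1 := by
  induction l generalizing T r with
  | nil =>
    rw [buildRings, mem_support_step] at hr
    simp [hr, Rings.insertAll]
  | cons i l ih =>
    rw [buildRings, mem_support_step_bind] at hr
    obtain ⟨t, ht, rfl⟩ := hr
    rw [mem_support_bind] at ht
    obtain ⟨u, hu, v, hv, rfl⟩ := ht
    rw [mem_support_ringKey] at hu
    subst hu
    rw [mem_support_bind] at hv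
    obtain ⟨u, hu, w, hw, rfl⟩ := hv
    obtain ⟨h1, h2⟩ := insertPoint_spec _ _ _ hu
    rw [h1] at hw
    obtain ⟨h3, h4⟩ := ih _ hw
    refine ⟨h3, ?_⟩
    simp only [List.length_cons]
    omega

theorem expect_buildRings {n m : ℕ} (z : ℕ) (ε : ℝ) (σ : Fin n → Fin m)
    (d : Fin n → Fin m → ℝ) (Δ : Fin m → ℝ) (l : List (Fin n)) (T : Rings n m)
    (F : Rings n m → ℝ≥0∞) :
    (buildRings z ε σ d Δ l T).expect F = F (T.insertAll (ringIndex z ε σ d Δ) l) := by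
  induction l generalizing T with
  | nil => rw [buildRings, expect_step, Rings.insertAll]
  | cons i l ih =>
    rw [buildRings, expect_bind, expect_step, expect_bind, expect_ringKey, expect_bind,
      expect_insertPoint, ih, Rings.insertAll]

theorem bucket_insertAll {n m : ℕ} (ρ : Fin n → Fin m × ℤ) (l : List (Fin n)) (T : Rings n m)
    (key : Fin m × ℤ) :
    ((T.insertAll ρ l).bucket key).toList =
      (T.bucket key).toList ++ l.filter (fun i => ρ i = key) := by
  induction l generalizing T with
  | nil => simp [Rings.insertAll]
  | cons i l ih =>
    rw [Rings.insertAll, ih]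
    by_cases h : ρ i = key
    · subst h
      simp [Rings.insert]
    · simp [Rings.insert, h, Function.update_of_ne (Ne.symm h)]

/-- Invariant: a key is listed exactly when its bucket is nonempty. A key is added only to an empty
bucket, so it is never listed twice. -/
theorem keys_insertAll {n m : ℕ} (ρ : Fin n → Fin m × ℤ) (l : List (Fin n)) (T : Rings n m)
    (hT : T.keys.Nodup) (hT' : ∀ key, key ∈ T.keys ↔ (T.bucket key).size ≠ 0) :
    (T.insertAll ρ l).keys.Nodup ∧ ∀ key, key ∈ (T.insertAll ρ l).keys ↔
      ((T.insertAll ρ l).bucket key).size ≠ 0 := by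
  induction l generalizing T with
  | nil => exact ⟨hT, hT'⟩
  | cons i l ih =>
    rw [Rings.insertAll]
    refine ih _ ?_ fun key => ?_
    · simp only [Rings.insert]
      split_ifs with h
      · exact List.nodup_cons.2 ⟨fun h' => (hT' _).1 h' h, hT⟩
      · exact hT
    · simp only [Rings.insert]
      by_cases h' : key = ρ i
      · subst h'
        split_ifs with h <;> simp [hT', h]
      · rw [Function.update_of_ne h', ← hT']
        split_ifs with h <;> simp [h']

/-- The rings of all points. -/
def allRings {n m : ℕ} (ρ : Fin n → Fin m × ℤ) : Rings n m :=
  Rings.insertAll ρ (List.finRange n) ⟨fun _ => #[], []⟩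

theorem bucket_allRings {n m : ℕ} (ρ : Fin n → Fin m × ℤ) (key : Fin m × ℤ) :
    ((allRings ρ).bucket key).toList = (List.finRange n).filter (fun i => ρ i = key) := by
  simp [allRings, bucket_insertAll]

theorem nodup_keys_allRings {n m : ℕ} (ρ : Fin n → Fin m × ℤ) : (allRings ρ).keys.Nodup :=
  (keys_insertAll ρ (List.finRange n) ⟨fun _ => #[], []⟩ (by simp) (by simp)).1

theorem toFinset_keys_allRings {n m : ℕ} (ρ : Fin n → Fin m × ℤ) :
    (allRings ρ).keys.toFinset = Finset.univ.image ρ := by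
  ext key
  have h := (keys_insertAll ρ (List.finRange n) ⟨fun _ => #[], []⟩ (by simp) (by simp)).2 key
  change key ∈ (allRings ρ).keys ↔ ((allRings ρ).bucket key).size ≠ 0 at h
  rw [List.mem_toFinset, h, ← Array.length_toList, bucket_allRings]
  simp

theorem sum_bucket_allRings {n m : ℕ} (ρ : Fin n → Fin m × ℤ) (key : Fin m × ℤ)
    (f : Fin n → ℝ) :
    (((allRings ρ).bucket key).toList.map f).sum = ∑ i with ρ i = key, f i := by
  rw [bucket_allRings]
  rw [← List.sum_toFinset _ ((List.nodup_finRange n).filter _)]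
  congr 1
  ext
  simp

theorem size_bucket_allRings {n m : ℕ} (ρ : Fin n → Fin m × ℤ) (key : Fin m × ℤ) :
    ((allRings ρ).bucket key).size = (Finset.univ.filter fun i => ρ i = key).card := by
  have h := sum_bucket_allRings ρ key fun _ => 1
  simp only [List.map_const', List.sum_replicate, Array.length_toList, nsmul_eq_mul, mul_one,
    Finset.sum_const] at h
  exact_mod_cast h

theorem sum_keys_allRings {M : Type*} [AddCommMonoid M] {n m : ℕ} (ρ : Fin n → Fin m × ℤ)
    (F : Fin m × ℤ → M) :
    ((allRings ρ).keys.map F).sum = ∑ key ∈ Finset.univ.image ρ, F key := by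
  rw [← toFinset_keys_allRings, List.sum_toFinset _ (nodup_keys_allRings ρ)]

theorem sum_image_sum_fiber {M : Type*} [AddCommMonoid M] {n : ℕ} {κ : Type*} [DecidableEq κ]
    (ρ : Fin n → κ) (f : Fin n → M) :
    ∑ key ∈ Finset.univ.image ρ, ∑ i with ρ i = key, f i = ∑ i, f i :=
  Finset.sum_fiberwise_of_maps_to (fun i _ => Finset.mem_image_of_mem ρ (Finset.mem_univ i)) f

theorem sum_image_card_mul {n : ℕ} {κ : Type*} [DecidableEq κ]
    (ρ : Fin n → κ) (h : κ → ℝ) :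
    ∑ key ∈ Finset.univ.image ρ, ((Finset.univ.filter fun i => ρ i = key).card : ℝ) * h key =
      ∑ i, h (ρ i) := by
  rw [← sum_image_sum_fiber ρ]
  refine Finset.sum_congr rfl fun key _ => ?_
  rw [← nsmul_eq_mul, ← Finset.sum_const]
  exact Finset.sum_congr rfl fun i hi => by rw [(Finset.mem_filter.1 hi).2]

/-! ### The whole algorithm -/

theorem ringSampling_spec {n m : ℕ} (z : ℕ) (ε : ℝ) (σ : Fin n → Fin m)
    (d : Fin n → Fin m → ℝ) (Δ : Fin m → ℝ) {δ : ℕ} (hδ : 0 < δ) {r : List (Fin n × ℝ) × ℕ}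
    (hr : r ∈ (ringSampling z ε σ d Δ δ).law.support) :
    (∀ e ∈ r.1, 0 < e.2) ∧
      r.1.length ≤ (Finset.univ.image (ringIndex z ε σ d Δ)).card * δ ∧
      (∀ h : Fin m × ℤ → ℝ, weightedSum r.1 (fun i => h (ringIndex z ε σ d Δ i)) =
        ∑ i, h (ringIndex z ε σ d Δ i)) ∧
      r.2 ≤ 23 * n + 3 := by
  set ρ := ringIndex z ε σ d Δ with hρ
  rw [ringSampling, mem_support_step_bind] at hr
  obtain ⟨t, ht, rfl⟩ := hr
  rw [mem_support_bind] at ht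
  obtain ⟨u, hu, v, hv, rfl⟩ := ht
  obtain ⟨h1, h2⟩ := buildRings_spec _ _ _ _ _ _ _ hu
  rw [← hρ] at h1
  change u.1 = allRings ρ at h1
  rw [h1] at hv
  obtain ⟨L, e1, e2, e3, e4, e5⟩ := sampleRings_spec hδ (allRings ρ) ρ
    (fun key i hi => by simpa [bucket_allRings] using hi) _ _ hv
  have hlen : (allRings ρ).keys.length = (Finset.univ.image ρ).card := by
    rw [← toFinset_keys_allRings, List.toFinset_card_of_nodup (nodup_keys_allRings ρ)]
  simp only [e1, List.append_nil]
  refine ⟨e2, hlen ▸ e3, fun h => ?_, ?_⟩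
  · rw [e4, sum_keys_allRings]
    simp only [size_bucket_allRings]
    exact sum_image_card_mul ρ h
  · have h3 : ((allRings ρ).keys.map fun key => ((allRings ρ).bucket key).size).sum = n := by
      rw [sum_keys_allRings]
      simp only [size_bucket_allRings, Finset.card_eq_sum_ones]
      rw [sum_image_sum_fiber ρ fun _ => 1]
      simp
    have h4 : (Finset.univ.image ρ).card ≤ n := Finset.card_image_le.trans (by simp)
    rw [h3, hlen] at e5
    simp only [List.length_finRange] at h2
    -- Per point `15` steps for insertion and at most `3` for output, and `5` per nonempty ring, of
    -- which there are at most `n`.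
    omega

theorem expect_ringSampling_le {n m : ℕ} (z : ℕ) (ε : ℝ) (σ : Fin n → Fin m)
    (d : Fin n → Fin m → ℝ) (Δ : Fin m → ℝ) {δ : ℕ} (hδ : 0 < δ) (c : Fin m × ℤ → ℝ)
    (t : ℝ) (g : Fin n → ℝ) (hg : ∀ i, |g i| ≤ c (ringIndex z ε σ d Δ i)) :
    (ringSampling z ε σ d Δ δ).expect
        (fun o => ENNReal.ofReal (Real.exp (t * weightedSum o g))) ≤
      ENNReal.ofReal (Real.exp (t * ∑ i, g i +
        t ^ 2 * (∑ i, c (ringIndex z ε σ d Δ i)) ^ 2 / (2 * δ))) := by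
  set ρ := ringIndex z ε σ d Δ with hρ
  rw [ringSampling, expect_bind, expect_step, expect_bind, expect_buildRings, ← hρ]
  change (sampleRings δ (allRings ρ) (allRings ρ).keys []).expect _ ≤ _
  refine (expect_sampleRings_le hδ (allRings ρ) c t g (fun key i hi => ?_) _ _).trans ?_
  · have h : ρ i = key := by simpa [bucket_allRings] using hi
    exact h ▸ hg i
  · have hd : (0 : ℝ) < δ := by exact_mod_cast hδ
    refine ENNReal.ofReal_le_ofReal (Real.exp_le_exp.2 ?_)
    rw [sum_keys_allRings, Finset.sum_add_distrib]
    simp only [sum_bucket_allRings, size_bucket_allRings]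
    rw [← Finset.mul_sum, sum_image_sum_fiber ρ g, ← sum_image_card_mul ρ c]
    simp only [weightedSum, List.map_nil, List.sum_nil, mul_zero, zero_add]
    rw [← Finset.sum_div, ← Finset.mul_sum]
    gcongr
    -- Bounding the sum of squares by the square of the sum keeps the number of rings out of `δ`.
    refine Finset.sum_sq_le_sq_sum_of_nonneg fun key hkey => ?_
    obtain ⟨i, -, rfl⟩ := Finset.mem_image.1 hkey
    exact mul_nonneg (Nat.cast_nonneg _) ((abs_nonneg _).trans (hg i))

/-! ### Concentration -/

/-- Markov's inequality: `F` is at least `1` on the bad outcomes. -/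
theorem le_toOuterMeasure_of_expect_le {α : Type} (x : RandM α) (G : Set (α × ℕ))
    (F : α → ℝ≥0∞) {π : ℝ} (hπ : 0 ≤ π) (hG : ∀ r ∈ x.law.support, r ∉ G → 1 ≤ F r.1)
    (hF : x.expect F ≤ ENNReal.ofReal π) :
    ENNReal.ofReal (1 - π) ≤ x.law.toOuterMeasure G := by
  rw [ENNReal.ofReal_sub _ hπ, ENNReal.ofReal_one, tsub_le_iff_right, ← x.law.tsum_coe,
    PMF.toOuterMeasure_apply]
  refine le_trans ?_ (add_le_add_right hF _)
  rw [RandM.expect, ← ENNReal.tsum_add]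
  refine ENNReal.tsum_le_tsum fun r => ?_
  by_cases hr : r ∈ G
  · simp [hr]
  · by_cases hs : r ∈ x.law.support
    · simpa [hr] using mul_le_mul_right (hG r hs hr) (x.law r)
    · rw [PMF.mem_support_iff, not_not] at hs
      simp [hs]

theorem expect_finset_sum {α : Type} {J : Type*} (s : Finset J) (x : RandM α)
    (F : J → α → ℝ≥0∞) :
    x.expect (fun o => ∑ j ∈ s, F j o) = ∑ j ∈ s, x.expect (F j) := by
  simp only [RandM.expect, Finset.mul_sum]
  exact Summable.tsum_finsetSum fun _ _ => ENNReal.summable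

theorem weightedSum_neg {n : ℕ} (L : List (Fin n × ℝ)) (g : Fin n → ℝ) :
    weightedSum L (fun i => -g i) = -weightedSum L g := by
  induction L with
  | nil => simp [weightedSum]
  | cons e L ih => rw [weightedSum_cons, weightedSum_cons, ih]; ring

/-- Chernoff's choice `t = θ δ / V`, with `V` the sum of the ring bounds: the exponent is
nonnegative once the deviation reaches `θ V`. If `V = 0`, then `t = 0` by the convention for
division. -/
theorem expect_exp_deviation_le {n m : ℕ} (z : ℕ) (ε : ℝ) (σ : Fin n → Fin m)
    (d : Fin n → Fin m → ℝ) (Δ : Fin m → ℝ) {δ : ℕ} (hδ : 0 < δ) (c : Fin m × ℤ → ℝ)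
    (g : Fin n → ℝ) (hg : ∀ i, |g i| ≤ c (ringIndex z ε σ d Δ i)) (θ : ℝ) :
    (ringSampling z ε σ d Δ δ).expect (fun o => ENNReal.ofReal
      (Real.exp (θ * δ / (∑ i, c (ringIndex z ε σ d Δ i)) * (weightedSum o g - ∑ i, g i) -
        θ ^ 2 * δ))) ≤ ENNReal.ofReal (Real.exp (-(θ ^ 2 * δ / 2))) := by
  set V := ∑ i, c (ringIndex z ε σ d Δ i) with hV
  set t := θ * δ / V with ht
  have hd : (0 : ℝ) < δ := by exact_mod_cast hδ
  have h1 : ∀ o : List (Fin n × ℝ), ENNReal.ofReal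
      (Real.exp (t * (weightedSum o g - ∑ i, g i) - θ ^ 2 * δ)) =
      ENNReal.ofReal (Real.exp (-(t * ∑ i, g i) - θ ^ 2 * δ)) *
        ENNReal.ofReal (Real.exp (t * weightedSum o g)) := by
    intro o
    rw [← ENNReal.ofReal_mul (Real.exp_nonneg _), ← Real.exp_add]
    ring_nf
  simp only [h1]
  rw [expect_const_mul]
  refine (mul_le_mul_right (expect_ringSampling_le z ε σ d Δ hδ c t g hg) _).trans ?_
  rw [← ENNReal.ofReal_mul (Real.exp_nonneg _), ← Real.exp_add]
  refine ENNReal.ofReal_le_ofReal (Real.exp_le_exp.2 ?_)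
  rw [← hV]
  have h2 : t ^ 2 * V ^ 2 / (2 * δ) ≤ θ ^ 2 * δ / 2 := by
    rcases eq_or_ne V 0 with h0 | h0
    · rw [h0]
      simp only [ne_eq, OfNat.ofNat_ne_zero, not_false_eq_true, zero_pow, mul_zero, zero_div]
      positivity
    · rw [ht]
      field_simp
      rfl
  linarith

/-- The test function sums the exponentials over all `j` and both signs. The event includes
membership in the support, so that the deterministic facts are available on it. -/
theorem deviation_bound {n m : ℕ} (z : ℕ) (ε : ℝ) (σ : Fin n → Fin m)
    (d : Fin n → Fin m → ℝ) (Δ : Fin m → ℝ) {δ : ℕ} (hδ : 0 < δ) {J : Type*} [Fintype J]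
    (c : J → Fin m × ℤ → ℝ) (g : J → Fin n → ℝ)
    (hg : ∀ j i, |g j i| ≤ c j (ringIndex z ε σ d Δ i)) {θ π : ℝ} (hθ : 0 < θ) (hπ : 0 ≤ π)
    (hJ : Fintype.card J * (2 * Real.exp (-(θ ^ 2 * δ / 2))) ≤ π) :
    ENNReal.ofReal (1 - π) ≤ (ringSampling z ε σ d Δ δ).law.toOuterMeasure
      {r | r ∈ (ringSampling z ε σ d Δ δ).law.support ∧
        ∀ j, |weightedSum r.1 (g j) - ∑ i, g j i| ≤ θ * ∑ i, c j (ringIndex z ε σ d Δ i)} := by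
  set ρ := ringIndex z ε σ d Δ with hρ
  set V : J → ℝ := fun j => ∑ i, c j (ρ i) with hV
  have hd : (0 : ℝ) < δ := by exact_mod_cast hδ
  let E : J → (Fin n → ℝ) → List (Fin n × ℝ) → ℝ≥0∞ := fun j g o => ENNReal.ofReal
      (Real.exp (θ * δ / V j * (weightedSum o g - ∑ i, g i) - θ ^ 2 * δ))
  have hE : ∀ j s, s ∈ Finset.univ (α := Bool) → (ringSampling z ε σ d Δ δ).expect
      (E j (fun i => if s then g j i else -g j i)) ≤
        ENNReal.ofReal (Real.exp (-(θ ^ 2 * δ / 2))) := by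
    intro j s _
    refine expect_exp_deviation_le z ε σ d Δ hδ (c j) _ (fun i => ?_) θ
    cases s
    · simpa using hg j i
    · simpa using hg j i
  refine le_toOuterMeasure_of_expect_le _ _
    (fun o => ∑ j, ∑ s : Bool, E j (fun i => if s then g j i else -g j i) o) hπ ?_ ?_
  · intro r hr hG
    simp only [Set.mem_ofPred_eq, hr, true_and, not_forall, not_le] at hG
    obtain ⟨j, hj⟩ := hG
    have hV0 : 0 ≤ V j := Finset.sum_nonneg fun i _ => (abs_nonneg _).trans (hg j i)
    rcases hV0.eq_or_lt with h0 | h0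
    -- Here the exponential carries no information, but `g j` vanishes and cannot deviate.
    · have hz : ∀ i, g j i = 0 := by
        have := (Finset.sum_eq_zero_iff_of_nonneg
          fun i _ => (abs_nonneg _).trans (hg j i)).1 h0.symm
        intro i
        exact abs_nonpos_iff.1 ((hg j i).trans (this i (Finset.mem_univ i)).le)
      have hw : weightedSum r.1 (g j) = 0 := by simp [weightedSum, hz]
      rw [hw] at hj
      simp only [hz, Finset.sum_const_zero, sub_zero, abs_zero] at hj
      exact absurd hj (not_lt.2 (mul_nonneg hθ.le hV0))
    · have hc : ∀ y : ℝ, θ * V j ≤ y →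
          1 ≤ ENNReal.ofReal (Real.exp (θ * δ / V j * y - θ ^ 2 * δ)) := by
        intro y hy
        rw [← ENNReal.ofReal_one]
        refine ENNReal.ofReal_le_ofReal (Real.one_le_exp ?_)
        have : θ * δ / V j * (θ * V j) ≤ θ * δ / V j * y :=
          mul_le_mul_of_nonneg_left hy (by positivity)
        have h2 : θ * δ / V j * (θ * V j) = θ ^ 2 * δ := by field_simp
        linarith
      have hs : ∃ s : Bool, 1 ≤ E j (fun i => if s then g j i else -g j i) r.1 := by
        rcases lt_abs.1 hj with h | h
        · exact ⟨true, hc _ (by simpa using h.le)⟩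
        · refine ⟨false, hc _ ?_⟩
          simp only [Bool.false_eq_true, if_false, weightedSum_neg, Finset.sum_neg_distrib]
          exact h.le.trans (by linarith)
      obtain ⟨s, hs⟩ := hs
      refine hs.trans (le_trans ?_ (Finset.single_le_sum (fun _ _ => zero_le)
        (Finset.mem_univ j)))
      exact Finset.single_le_sum
        (f := fun s => E j (fun i => if s = true then g j i else -g j i) r.1)
        (fun _ _ => zero_le) (Finset.mem_univ s)
  · rw [expect_finset_sum]
    simp only [expect_finset_sum]
    refine (Finset.sum_le_sum fun j _ => Finset.sum_le_sum (hE j)).trans ?_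
    refine le_trans (le_of_eq ?_) (ENNReal.ofReal_le_ofReal hJ)
    rw [ENNReal.ofReal_mul (by positivity), ENNReal.ofReal_mul (by positivity)]
    simp

/-! ### Deterministic comparison of the sums -/

theorem weightedSum_eq_sum {n : ℕ} (L : List (Fin n × ℝ)) (hL : ∀ e ∈ L, 0 < e.2) :
    ∃ W : Fin n → ℝ, (∀ i, 0 ≤ W i) ∧ ∀ g, weightedSum L g = ∑ i, W i * g i := by
  induction L with
  | nil => exact ⟨0, by simp [weightedSum]⟩
  | cons e L ih =>
    obtain ⟨W, h1, h2⟩ := ih fun e he => hL e (List.mem_cons_of_mem _ he)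
    refine ⟨fun i => (if i = e.1 then e.2 else 0) + W i, fun i => ?_, fun g => ?_⟩
    · have := (hL e (by simp)).le
      have := h1 i
      dsimp only
      split_ifs <;> linarith
    · rw [weightedSum_cons, h2]
      simp [add_mul, Finset.sum_add_distrib]

/-- Here `f` is the cost for `S`, `g` the cost for `S'` on near rings, `v` the constant value on far
rings and `a` the cost for `A`. As `v ∘ ρ` is summed exactly, the error consists of `f - g - v ∘ ρ`,
summed once plainly and once with the sampled weights, and of the deviation of `g`. -/
theorem weightedSum_sub_sum_le {n : ℕ} {κ : Type*} (ρ : Fin n → κ) {ε : ℝ} (hε : 0 < ε)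
    (hε' : ε < 1 / 3) (L : List (Fin n × ℝ)) (hL : ∀ e ∈ L, 0 < e.2)
    (hmass : ∀ h : κ → ℝ, weightedSum L (fun i => h (ρ i)) = ∑ i, h (ρ i))
    (f g a : Fin n → ℝ) (v : κ → ℝ) (ha : ∀ i, 0 ≤ a i)
    (hfg : ∀ i, (0 ≤ g i ∧ v (ρ i) = 0 ∧ |f i - g i| ≤ ε * (f i + a i)) ∨
      (g i = 0 ∧ 0 ≤ v (ρ i) ∧ |f i - v (ρ i)| ≤ 2 * ε * v (ρ i)))
    (hg : |weightedSum L g - ∑ i, g i| ≤ ε * (∑ i, g i + ∑ i, a i))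
    (hA : |weightedSum L a - ∑ i, a i| ≤ 2 * ε * ∑ i, a i) :
    |∑ i, f i - weightedSum L f| ≤ 20 * ε * (∑ i, f i + ∑ i, a i) := by
  obtain ⟨W, hW, hs⟩ := weightedSum_eq_sum L hL
  have hv := hmass v
  rw [hs] at hv hg hA ⊢
  have hsplit : ∑ i, f i - ∑ i, W i * f i = ∑ i, (f i - g i - v (ρ i)) -
      ∑ i, W i * (f i - g i - v (ρ i)) - (∑ i, W i * g i - ∑ i, g i) := by
    simp only [mul_sub, Finset.sum_sub_distrib, hv]
    ring
  have hpt : ∀ i, |f i - g i - v (ρ i)| ≤ ε * (2 * g i + 3 * a i + 2 * v (ρ i)) := by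
    intro i
    have hai := ha i
    rcases hfg i with ⟨h1, h2, h3⟩ | ⟨h1, h2, h3⟩
    · have h4 : f i ≤ 2 * g i + 2 * a i := by
        have h5 := (abs_le.1 h3).2
        by_contra h6
        have h7 : ε * (f i + a i) ≤ 1 / 3 * (f i + a i) :=
          mul_le_mul_of_nonneg_right hε'.le (by linarith)
        linarith
      rw [h2, sub_zero]
      refine h3.trans (mul_le_mul_of_nonneg_left ?_ hε.le)
      linarith
    · rw [h1, sub_zero]
      refine h3.trans ?_
      have : 0 ≤ ε * a i := mul_nonneg hε.le hai
      linarith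
  have hdom : ∀ i, g i + v (ρ i) ≤ 3 * f i + a i := by
    intro i
    have hai := ha i
    rcases hfg i with ⟨h1, h2, h3⟩ | ⟨h1, h2, h3⟩
    · have h5 := (abs_le.1 h3).1
      rcases le_total 0 (f i + a i) with h6 | h6
      · have h7 : ε * (f i + a i) ≤ 1 / 3 * (f i + a i) :=
          mul_le_mul_of_nonneg_right hε'.le h6
        rw [h2]
        linarith
      -- No sign of `f` is assumed; this case forces `f i + a i = 0` and then `f i = g i`.
      · have h7 := (abs_nonneg _).trans h3
        have h8 : ε * (f i + a i) ≤ 0 := mul_nonpos_of_nonneg_of_nonpos hε.le h6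
        have h9 : f i + a i = 0 := by
          have : ε * (f i + a i) = 0 := le_antisymm h8 h7
          rcases mul_eq_zero.1 this with h | h
          · linarith
          · exact h
        rw [h9, mul_zero] at h3
        have := abs_nonpos_iff.1 h3
        rw [h2]
        linarith
    · have h5 := (abs_le.1 h3).1
      have h7 : ε * v (ρ i) ≤ 1 / 3 * v (ρ i) := mul_le_mul_of_nonneg_right hε'.le h2
      rw [h1]
      linarith
  have e1 : |∑ i, (f i - g i - v (ρ i))| ≤
      ε * (2 * ∑ i, g i + 3 * ∑ i, a i + 2 * ∑ i, v (ρ i)) := by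
    refine (Finset.abs_sum_le_sum_abs _ _).trans ((Finset.sum_le_sum fun i _ => hpt i).trans ?_)
    simp only [← Finset.mul_sum, Finset.sum_add_distrib]
    exact le_rfl
  have e2 : |∑ i, W i * (f i - g i - v (ρ i))| ≤
      ε * (2 * ∑ i, W i * g i + 3 * ∑ i, W i * a i + 2 * ∑ i, v (ρ i)) := by
    refine (Finset.abs_sum_le_sum_abs _ _).trans ((Finset.sum_le_sum
      (g := fun i => W i * (ε * (2 * g i + 3 * a i + 2 * v (ρ i)))) fun i _ => ?_).trans ?_)
    · rw [abs_mul, abs_of_nonneg (hW i)]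
      exact mul_le_mul_of_nonneg_left (hpt i) (hW i)
    · rw [← hv]
      simp only [Finset.mul_sum, ← Finset.sum_add_distrib]
      exact Finset.sum_le_sum fun i _ => le_of_eq (by ring)
  have e3 : ∑ i, g i + ∑ i, v (ρ i) ≤ 3 * ∑ i, f i + ∑ i, a i := by
    simp only [Finset.mul_sum, ← Finset.sum_add_distrib]
    exact Finset.sum_le_sum fun i _ => hdom i
  have hG : 0 ≤ ∑ i, g i := Finset.sum_nonneg fun i _ => by
    rcases hfg i with h | h
    · exact h.1
    · exact h.1.ge
  have hV : 0 ≤ ∑ i, v (ρ i) := Finset.sum_nonneg fun i _ => by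
    rcases hfg i with h | h
    · exact h.2.1.ge
    · exact h.2.1
  have hA0 : 0 ≤ ∑ i, a i := Finset.sum_nonneg fun i _ => ha i
  set G := ∑ i, g i
  set V := ∑ i, v (ρ i)
  set A := ∑ i, a i
  set F := ∑ i, f i
  set G' := ∑ i, W i * g i
  set A' := ∑ i, W i * a i
  have hG' : G' ≤ 4 / 3 * G + 1 / 3 * A := by
    have h1 := (abs_le.1 hg).2
    have h2 : ε * (G + A) ≤ 1 / 3 * (G + A) := mul_le_mul_of_nonneg_right hε'.le (by linarith)
    linarith
  have hA' : A' ≤ 5 / 3 * A := by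
    have h1 := (abs_le.1 hA).2
    have h2 : ε * A ≤ 1 / 3 * A := mul_le_mul_of_nonneg_right hε'.le hA0
    linarith
  rw [hsplit]
  refine (abs_sub _ _).trans ((add_le_add (abs_sub _ _) le_rfl).trans
    ((add_le_add (add_le_add e1 e2) hg).trans ?_))
  rw [← mul_add, ← mul_add, mul_assoc, mul_left_comm]
  refine mul_le_mul_of_nonneg_left ?_ hε.le
  -- The bracket is at most `17/3 G + 29/3 A + 4 V`, hence at most `17 F + 46/3 A`.
  linarith

/-! ### Costs within a ring -/

section Metric

variable {X : Type*} [MetricSpace X]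

theorem bddBelow_range_dist {k : ℕ} (p : X) (S : Fin k → X) :
    BddBelow (Set.range fun j => dist p (S j)) :=
  ⟨0, by rintro _ ⟨j, rfl⟩; exact dist_nonneg⟩

theorem iInf_dist_nonneg {k : ℕ} (p : X) (S : Fin k → X) : 0 ≤ ⨅ j, dist p (S j) :=
  Real.iInf_nonneg fun _ => dist_nonneg

theorem cost_nonneg {k : ℕ} (z : ℕ) (p : X) (S : Fin k → X) : 0 ≤ cost z p S :=
  pow_nonneg (iInf_dist_nonneg p S) z

theorem iInf_dist_le_add {k : ℕ} (p q : X) (S : Fin k → X) :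
    ⨅ j, dist p (S j) ≤ (⨅ j, dist q (S j)) + dist p q := by
  rcases isEmpty_or_nonempty (Fin k) with h | h
  · simp [Real.iInf_of_isEmpty]
  · rw [← sub_le_iff_le_add]
    refine le_ciInf fun j => ?_
    rw [sub_le_iff_le_add]
    refine (ciInf_le (bddBelow_range_dist p S) j).trans ?_
    linarith [dist_triangle p q (S j)]

theorem IsNearestAssignment.iInf_dist_eq {n m : ℕ} {P : Fin n → X} {A : Fin m → X}
    {σ : Fin n → Fin m} (h : IsNearestAssignment P A σ) (i : Fin n) :
    ⨅ j, dist (P i) (A j) = dist (P i) (A (σ i)) :=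
  have : Nonempty (Fin m) := ⟨σ i⟩
  le_antisymm (ciInf_le (bddBelow_range_dist _ _) _) (le_ciInf (h i))

/-- Equal floors of the binary logarithms mean a ratio below `2`. If `Δ (σ i) ≤ 0`, the range
condition forces distance `0`. -/
theorem dist_center_le_two_mul {n m : ℕ} {z : ℕ} (hz : 1 ≤ z) {ε : ℝ} (hε : 0 < ε)
    {P : Fin n → X} {A : Fin m → X} {σ : Fin n → Fin m} {Δ : Fin m → ℝ}
    (hΔ : ClustersInRange z ε P A σ Δ) {i i' : Fin n}
    (h : ringIndex z ε σ (fun i c => dist (P i) (A c)) Δ i =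
      ringIndex z ε σ (fun i c => dist (P i) (A c)) Δ i') :
    dist (P i) (A (σ i)) ≤ 2 * dist (P i') (A (σ i)) := by
  simp only [ringIndex, Prod.mk.injEq] at h
  obtain ⟨h1, h2⟩ := h
  obtain ⟨l1, u1⟩ := hΔ i
  obtain ⟨l2, u2⟩ := hΔ i'
  rw [← h1] at h2 l2 u2
  have hz' : (0 : ℝ) < z := by exact_mod_cast hz
  rcases le_or_gt (Δ (σ i)) 0 with h0 | h0
  · have : (z / ε) ^ 2 * Δ (σ i) ≤ 0 := mul_nonpos_of_nonneg_of_nonpos (by positivity) h0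
    have := dist_nonneg (x := P i') (y := A (σ i))
    linarith
  · rw [← sq] at h2
    have hb : 0 < (ε / z) ^ 2 * Δ (σ i) := by positivity
    set B := (ε / z) ^ 2 * Δ (σ i)
    have h3 := (abs_lt.1 (Int.abs_sub_lt_one_of_floor_eq_floor h2)).2
    have hd1 : 0 < dist (P i) (A (σ i)) := hb.trans_le l1
    have hd2 : 0 < dist (P i') (A (σ i)) := hb.trans_le l2
    have h4 : Real.logb 2 (dist (P i) (A (σ i)) / B) <
        Real.logb 2 (2 * (dist (P i') (A (σ i)) / B)) := by
      rw [Real.logb_mul (by norm_num) (by positivity), Real.logb_self_eq_one (by norm_num)]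
      linarith
    rw [Real.logb_lt_logb_iff (by norm_num) (by positivity) (by positivity), ← mul_div_assoc,
      div_lt_div_iff_of_pos_right hb] at h4
    exact h4.le

theorem dist_le_three_mul_iInf {n m : ℕ} {z : ℕ} (hz : 1 ≤ z) {ε : ℝ} (hε : 0 < ε)
    {P : Fin n → X} {A : Fin m → X} {σ : Fin n → Fin m} {Δ : Fin m → ℝ}
    (hσ : IsNearestAssignment P A σ) (hΔ : ClustersInRange z ε P A σ Δ) {i i' : Fin n}
    (h : ringIndex z ε σ (fun i c => dist (P i) (A c)) Δ i =
      ringIndex z ε σ (fun i c => dist (P i) (A c)) Δ i') :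
    dist (P i) (P i') ≤ 3 * ⨅ j, dist (P i') (A j) := by
  have h1 := dist_center_le_two_mul hz hε hΔ h
  have h2 : σ i = σ i' := congrArg Prod.fst h
  rw [hσ.iInf_dist_eq, ← h2]
  linarith [dist_triangle_right (P i) (P i') (A (σ i))]

/-- With `x`, `y` the distances of `P i'` to `S` and `A`, the distance of `P i` to `S` is at most `x
+ 3 y ≤ 4 max x y`. -/
theorem cost_le_of_ring {n m k : ℕ} {z : ℕ} (hz : 1 ≤ z) {ε : ℝ} (hε : 0 < ε)
    {P : Fin n → X} {A : Fin m → X} {σ : Fin n → Fin m} {Δ : Fin m → ℝ}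
    (hσ : IsNearestAssignment P A σ) (hΔ : ClustersInRange z ε P A σ Δ) {i i' : Fin n}
    (h : ringIndex z ε σ (fun i c => dist (P i) (A c)) Δ i =
      ringIndex z ε σ (fun i c => dist (P i) (A c)) Δ i') (S : Fin k → X) :
    cost z (P i) S ≤ 8 ^ z * (cost z (P i') S + cost z (P i') A) := by
  have h1 := dist_le_three_mul_iInf hz hε hσ hΔ h
  have h2 := iInf_dist_le_add (P i) (P i') S
  have h3 := iInf_dist_nonneg (P i') S
  have h4 := iInf_dist_nonneg (P i') A
  unfold cost
  set x := ⨅ j, dist (P i') (S j)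
  set y := ⨅ j, dist (P i') (A j)
  have h5 : ⨅ j, dist (P i) (S j) ≤ 4 * max x y := by
    linarith [le_max_left x y, le_max_right x y]
  calc (⨅ j, dist (P i) (S j)) ^ z ≤ (4 * max x y) ^ z :=
        pow_le_pow_left₀ (iInf_dist_nonneg _ _) h5 z
    _ = 4 ^ z * max x y ^ z := mul_pow _ _ _
    _ ≤ 8 ^ z * (x ^ z + y ^ z) := by
        refine mul_le_mul (pow_le_pow_left₀ (by norm_num) (by norm_num) z) ?_
          (pow_nonneg (le_max_of_le_left h3) z) (by positivity)
        rcases max_choice x y with h | h <;> rw [h]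
        · linarith [pow_nonneg h4 z]
        · linarith [pow_nonneg h3 z]

/-- Bernoulli's inequality gives the lower bound, and `(1 + ε/z)^z ≤ exp ε ≤ 1 + 2ε` the upper one.
-/
theorem abs_pow_sub_pow_le {x x' ε : ℝ} {z : ℕ} (hz : 1 ≤ z) (hε : 0 < ε) (hε' : ε ≤ 1)
    (hx : 0 ≤ x) (hx' : 0 ≤ x') (h : |x' - x| ≤ ε / z * x) :
    |x' ^ z - x ^ z| ≤ 2 * ε * x ^ z := by
  have hz' : (0 : ℝ) < z := by exact_mod_cast hz
  have hz1 : (1 : ℝ) ≤ z := by exact_mod_cast hz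
  obtain ⟨h1, h2⟩ := abs_le.1 h
  have hxz := pow_nonneg hx z
  have hle : ε / z ≤ 1 := (div_le_one hz').2 (hε'.trans hz1)
  rw [abs_le]
  constructor
  · have h3 : (1 - ε / z) * x ≤ x' := by linarith
    have h4 := pow_le_pow_left₀ (mul_nonneg (by linarith) hx) h3 z
    rw [mul_pow] at h4
    have h5 := one_add_mul_le_pow (a := -(ε / z)) (by linarith) z
    have h6 : 1 + (z : ℝ) * -(ε / z) = 1 - ε := by field_simp; ring
    rw [h6, ← sub_eq_add_neg] at h5
    have h7 := mul_le_mul_of_nonneg_right h5 hxz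
    have h8 := mul_nonneg hε.le hxz
    linarith
  · have h3 : x' ≤ (1 + ε / z) * x := by linarith
    have h4 := pow_le_pow_left₀ hx' h3 z
    rw [mul_pow] at h4
    have h5 : (1 + ε / z) ^ z ≤ 1 + 2 * ε := by
      calc (1 + ε / z) ^ z ≤ Real.exp (ε / z) ^ z := by
            refine pow_le_pow_left₀ (by positivity) ?_ z
            linarith [Real.add_one_le_exp (ε / z)]
        _ = Real.exp ε := by
            rw [← Real.exp_nat_mul]
            congr 1
            field_simp
        _ ≤ 1 + 2 * ε := by
            have := (abs_le.1 (Real.abs_exp_sub_one_le (x := ε) (by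
              rwa [abs_of_pos hε]))).2
            rw [abs_of_pos hε] at this
            linarith
    have h7 := mul_le_mul_of_nonneg_right h5 hxz
    linarith

theorem precision_le {z : ℕ} (hz : 1 ≤ z) {ε : ℝ} (hε : 0 < ε) (hε' : ε < 1 / 3) :
    ε / (z * Real.log (z / ε)) ≤ ε := by
  have hz1 : (1 : ℝ) ≤ z := by exact_mod_cast hz
  have h1 : Real.exp 1 ≤ z / ε := by
    rw [le_div_iff₀ hε]
    have := Real.exp_one_lt_d9
    nlinarith
  have h2 : 1 ≤ Real.log (z / ε) := by
    rw [Real.le_log_iff_exp_le (by positivity)]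
    exact h1
  exact div_le_self hε.le (one_le_mul_of_one_le_of_one_le hz1 h2)

theorem exists_constant_of_far {n m k : ℕ} {z : ℕ} (hz : 1 ≤ z) {ε : ℝ} (hε : 0 < ε)
    (hε' : ε < 1 / 3) {P : Fin n → X} {A : Fin m → X} {σ : Fin n → Fin m} {Δ : Fin m → ℝ}
    (hσ : IsNearestAssignment P A σ) (hΔ : ClustersInRange z ε P A σ Δ)
    (S S' : Fin k → X) {i : Fin n}
    (hS : cost z (P i) S ≤ (8 * z / ε) ^ z * cost z (P i) A →
      |cost z (P i) S - cost z (P i) S'| ≤ ε * (cost z (P i) S + cost z (P i) A))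
    (hi : (8 * z / ε) ^ z * cost z (P i) A < cost z (P i) S') {i' : Fin n}
    (h : ringIndex z ε σ (fun i c => dist (P i) (A c)) Δ i' =
      ringIndex z ε σ (fun i c => dist (P i) (A c)) Δ i) :
    |cost z (P i') S - cost z (P i) S| ≤ 2 * ε * cost z (P i) S := by
  have hz1 : (1 : ℝ) ≤ z := by exact_mod_cast hz
  have hd := dist_le_three_mul_iInf hz hε hσ hΔ h
  have h1 := iInf_dist_le_add (P i) (P i') S
  have h2 := iInf_dist_le_add (P i') (P i) S
  have hx := iInf_dist_nonneg (P i) S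
  have hx' := iInf_dist_nonneg (P i') S
  have hy := iInf_dist_nonneg (P i) A
  rw [dist_comm] at h1
  unfold cost at hS hi ⊢
  set x := ⨅ j, dist (P i) (S j)
  set x' := ⨅ j, dist (P i') (S j)
  set y := ⨅ j, dist (P i) (A j)
  set w := ⨅ j, dist (P i) (S' j)
  -- If `x < Y = (4z/ε) y`, the centroid property applies and gives `w^z ≤ 5/3 Y^z < (2Y)^z`, or
  -- equality to `0`, against `hi`. So `S` is far too, and the ring's diameter is small relative to
  -- `x`.
  have hfar : 4 * z / ε * y ≤ x := by
    by_contra hlt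
    push Not at hlt
    set Y := 4 * z / ε * y with hY
    have hY2 : 8 * z / ε * y = 2 * Y := by rw [hY]; ring
    have hY0 : 0 ≤ Y := hx.trans hlt.le
    have hyY : y ≤ Y := by
      refine le_mul_of_one_le_left hy ?_
      rw [le_div_iff₀ hε]
      linarith
    rw [← mul_pow, hY2] at hi hS
    have hxY := pow_le_pow_left₀ hx hlt.le z
    have hyYz := pow_le_pow_left₀ hy hyY z
    have hYz := pow_nonneg hY0 z
    have h2Y : 2 * Y ^ z ≤ (2 * Y) ^ z := by
      rw [mul_pow 2 Y]
      exact mul_le_mul_of_nonneg_right (le_self_pow₀ (by norm_num : (1 : ℝ) ≤ 2)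
        (Nat.one_le_iff_ne_zero.1 hz)) hYz
    have h3 := (abs_le.1 (hS (by linarith))).1
    have h4 : ε * (x ^ z + y ^ z) ≤ 1 / 3 * (x ^ z + y ^ z) :=
      mul_le_mul_of_nonneg_right hε'.le (add_nonneg (pow_nonneg hx z) (pow_nonneg hy z))
    linarith
  refine abs_pow_sub_pow_le hz hε (by linarith) hx hx' ?_
  have h5 : 3 * y ≤ ε / z * x := by
    have h6 : ε / z * (4 * z / ε * y) ≤ ε / z * x :=
      mul_le_mul_of_nonneg_left hfar (by positivity)
    have h7 : ε / z * (4 * z / ε * y) = 4 * y := by field_simp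
    linarith
  rw [abs_le]
  constructor <;> linarith

end Metric

/-- The bound `c` is the maximum of `g` on the ring; it is attained in the ring, where `h` applies.
-/
theorem exists_ring_bound {n : ℕ} {κ : Type*} (ρ : Fin n → κ) {B : ℝ} (g a : Fin n → ℝ)
    (hg : ∀ i, 0 ≤ g i) (h : ∀ i i', ρ i = ρ i' → g i ≤ B * (g i' + a i')) :
    ∃ c : κ → ℝ, (∀ i, |g i| ≤ c (ρ i)) ∧ ∀ i, c (ρ i) ≤ B * (g i + a i) := by
  classical
  have h1 : ∀ key, ∃ c, ∀ i, ρ i = key → |g i| ≤ c ∧ c ≤ B * (g i + a i) := by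
    intro key
    rcases (Finset.univ.filter fun i => ρ i = key).eq_empty_or_nonempty with h0 | h0
    · refine ⟨0, fun i hi => ?_⟩
      have : i ∈ Finset.univ.filter fun i => ρ i = key := by simp [hi]
      simp [h0] at this
    · obtain ⟨i₀, hi₀, hmax⟩ := Finset.exists_max_image _ g h0
      refine ⟨g i₀, fun i hi => ⟨?_, h _ _ ?_⟩⟩
      · rw [abs_of_nonneg (hg i)]
        exact hmax i (by simp [hi])
      · rw [(Finset.mem_filter.1 hi₀).2, hi]
  choose c hc using h1
  exact ⟨c, fun i => (hc _ i rfl).1, fun i => (hc _ i rfl).2⟩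

/-! ### Estimates for the parameters -/

theorem one_le_log_one_div {ε : ℝ} (hε : 0 < ε) (hε' : ε < 1 / 3) : 1 ≤ Real.log (1 / ε) := by
  rw [Real.le_log_iff_exp_le (by positivity), le_div_iff₀ hε]
  have := Real.exp_one_lt_d9
  nlinarith

/-- This is where the degenerate case is excluded. The lower bound makes `δ` positive, absorbs its
rounding and pays for constants in the union bound. -/
theorem log_two_le_entropyTerm {k N : ℕ} {π : ℝ} (hk : 1 ≤ k) (hπ : 0 < π) (hπ' : π < 1)
    (h : 2 ≤ k ∨ 2 ≤ N ∨ π ≤ 1 / 2) : Real.log 2 ≤ entropyTerm k N π := by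
  have hk1 : (1 : ℝ) ≤ k := by exact_mod_cast hk
  have h1 : 0 ≤ Real.log k := Real.log_natCast_nonneg k
  have h2 : 0 ≤ Real.log N := Real.log_natCast_nonneg N
  have h3 : 0 ≤ Real.log (1 / π) := Real.log_nonneg ((one_le_div hπ).2 hπ'.le)
  have h1' : Real.log k ≤ k * Real.log k := le_mul_of_one_le_left h1 hk1
  have h2' : Real.log N ≤ k * Real.log N := le_mul_of_one_le_left h2 hk1
  unfold entropyTerm
  rcases h with h | h | h
  · have : Real.log 2 ≤ Real.log k := Real.log_le_log (by norm_num) (by exact_mod_cast h)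
    linarith
  · have : Real.log 2 ≤ Real.log N := Real.log_le_log (by norm_num) (by exact_mod_cast h)
    linarith
  · have : Real.log 2 ≤ Real.log (1 / π) :=
      Real.log_le_log (by norm_num) (by rw [le_div_iff₀ hπ]; linarith)
    linarith

/-- Put `u = exp (-T)`. Both `N ^ k * u` and `u` are at most `π`; the two remaining factors `u ≤
1/2` pay for the constant `4`. -/
theorem union_bound_le {k N : ℕ} {π : ℝ} (hk : 1 ≤ k) (hπ : 0 < π) (hπ' : π < 1)
    (h : 2 ≤ k ∨ 2 ≤ N ∨ π ≤ 1 / 2) {x : ℝ} (hx : 3 * entropyTerm k N π ≤ x) :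
    ((N : ℝ) ^ k + 1) * (2 * Real.exp (-x)) ≤ π := by
  have hT := log_two_le_entropyTerm hk hπ hπ' h
  set T := entropyTerm k N π with hTdef
  have h1 : 0 ≤ Real.log k := Real.log_natCast_nonneg k
  have h2 : 0 ≤ Real.log N := Real.log_natCast_nonneg N
  set u := Real.exp (-T) with hu
  have hu0 : 0 < u := Real.exp_pos _
  have hexp : Real.exp (-x) ≤ u ^ 3 := by
    rw [hu, ← Real.exp_nat_mul]
    refine Real.exp_le_exp.2 ?_
    push_cast
    linarith
  have hhalf : u ≤ 1 / 2 := by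
    have : u ≤ Real.exp (-Real.log 2) := Real.exp_le_exp.2 (by linarith)
    rw [Real.exp_neg, Real.exp_log (by norm_num)] at this
    linarith
  have hlogπ : Real.exp (-Real.log (1 / π)) = π := by
    rw [one_div, Real.log_inv, neg_neg, Real.exp_log hπ]
  have hk0 : (0 : ℝ) ≤ k := Nat.cast_nonneg k
  have huπ : u ≤ π := by
    rw [← hlogπ]
    refine Real.exp_le_exp.2 ?_
    rw [hTdef, entropyTerm]
    linarith [mul_nonneg hk0 h1, mul_nonneg hk0 h2]
  have hN : (N : ℝ) ^ k * u ≤ π := by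
    rcases Nat.eq_zero_or_pos N with h0 | h0
    · rw [h0, Nat.cast_zero, zero_pow (by omega), zero_mul]
      exact hπ.le
    · have h0' : (0 : ℝ) < N := by exact_mod_cast h0
      rw [← Real.exp_log (pow_pos h0' k), Real.log_pow, hu, ← Real.exp_add, ← hlogπ]
      refine Real.exp_le_exp.2 ?_
      rw [hTdef, entropyTerm]
      linarith [mul_nonneg hk0 h1]
  have h3 : u ^ 2 ≤ 1 / 4 := by
    have := pow_le_pow_left₀ hu0.le hhalf 2
    linarith
  calc ((N : ℝ) ^ k + 1) * (2 * Real.exp (-x)) ≤ ((N : ℝ) ^ k + 1) * (2 * u ^ 3) := by gcongr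
    _ = 2 * ((N : ℝ) ^ k * u + u) * u ^ 2 := by ring
    _ ≤ 2 * (π + π) * (1 / 4) := by gcongr
    _ = π := by ring

/-- The condition `6 ≤ K` serves twice: as the factor `6`, and for `(8 ^ z) ^ 2 = 2 ^ (6 z) ≤ 2 ^ (K
z)`. -/
theorem three_mul_entropyTerm_le {K k z N : ℕ} {ε π : ℝ} (hK : 6 ≤ K) (hε : 0 < ε)
    (hε' : ε < 1 / 3) (hT : 0 ≤ entropyTerm k N π) :
    3 * entropyTerm k N π ≤ (ε / 8 ^ z) ^ 2 * samplesPerRing K k z N ε π / 2 := by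
  have hL := one_le_log_one_div hε hε'
  have h1 : (K : ℝ) * 2 ^ (K * z) * (Real.log (1 / ε) ^ 2 / ε ^ 2) * entropyTerm k N π ≤
      samplesPerRing K k z N ε π := Nat.le_ceil _
  set T := entropyTerm k N π
  have h2 : 6 * (8 ^ z) ^ 2 * (1 / ε ^ 2) * T ≤
      K * 2 ^ (K * z) * (Real.log (1 / ε) ^ 2 / ε ^ 2) * T := by
    have hK' : (6 : ℝ) ≤ K := by exact_mod_cast hK
    have hp : ((8 : ℝ) ^ z) ^ 2 ≤ 2 ^ (K * z) := by
      rw [← pow_mul, show (8 : ℝ) = 2 ^ 3 by norm_num, ← pow_mul]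
      refine pow_le_pow_right₀ (by norm_num) ?_
      nlinarith
    have hL2 : (1 : ℝ) ≤ Real.log (1 / ε) ^ 2 := one_le_pow₀ hL
    gcongr
  have h3 : (ε / 8 ^ z) ^ 2 * (6 * (8 ^ z) ^ 2 * (1 / ε ^ 2) * T) / 2 = 3 * T := by
    field_simp
    ring
  rw [← h3]
  gcongr
  exact h2.trans h1

theorem samplesPerRing_le {K k z N : ℕ} {ε π : ℝ} (hK : 2 ≤ K) (hε : 0 < ε) (hε' : ε < 1 / 3)
    (hT : Real.log 2 ≤ entropyTerm k N π) :
    0 < samplesPerRing K k z N ε π ∧ (samplesPerRing K k z N ε π : ℝ) ≤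
      2 * (K * 2 ^ (K * z) * (Real.log (1 / ε) ^ 2 / ε ^ 2) * entropyTerm k N π) := by
  have hL := one_le_log_one_div hε hε'
  have h2 := Real.log_two_gt_d9
  have h1 : 1 ≤ (K : ℝ) * 2 ^ (K * z) * (Real.log (1 / ε) ^ 2 / ε ^ 2) * entropyTerm k N π := by
    have hK' : (2 : ℝ) ≤ K := by exact_mod_cast hK
    have hp : (1 : ℝ) ≤ 2 ^ (K * z) := one_le_pow₀ (by norm_num)
    have hL2 : (1 : ℝ) ≤ Real.log (1 / ε) ^ 2 / ε ^ 2 := by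
      rw [le_div_iff₀ (by positivity), one_mul]
      exact (pow_le_one₀ hε.le (by linarith)).trans (one_le_pow₀ hL)
    calc (1 : ℝ) ≤ 2 * 1 * 1 * Real.log 2 := by linarith
      _ ≤ _ := by gcongr
  refine ⟨Nat.ceil_pos.2 (by linarith), ?_⟩
  have h3 := Nat.ceil_lt_add_one (zero_le_one.trans h1)
  rw [samplesPerRing]
  linarith

/-! ### The number of rings -/

section Rings

variable {X : Type*} [MetricSpace X] {n m z : ℕ} {ε : ℝ} {P : Fin n → X} {A : Fin m → X}
  {σ : Fin n → Fin m} {Δ : Fin m → ℝ}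

theorem ringIndex_snd_mem (hz : 1 ≤ z) (hε : 0 < ε) (hε' : ε < 1)
    (hΔ : ClustersInRange z ε P A σ Δ) (i : Fin n) :
    (ringIndex z ε σ (fun i c => dist (P i) (A c)) Δ i).2 ∈
      Finset.Icc 0 ⌊4 * Real.logb 2 (z / ε)⌋ := by
  obtain ⟨l, u⟩ := hΔ i
  have hz1 : (1 : ℝ) ≤ z := by exact_mod_cast hz
  have hzε : 1 ≤ z / ε := (one_le_div hε).2 (by linarith)
  have hlog : 0 ≤ Real.logb 2 (z / ε) := Real.logb_nonneg (by norm_num) hzε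
  simp only [ringIndex, Finset.mem_Icc]
  rw [← sq]
  rcases le_or_gt (Δ (σ i)) 0 with h0 | h0
  · have h1 : (z / ε) ^ 2 * Δ (σ i) ≤ 0 := mul_nonpos_of_nonneg_of_nonpos (by positivity) h0
    have h2 : dist (P i) (A (σ i)) = 0 := le_antisymm (u.trans h1) dist_nonneg
    -- Since `logb 2 0 = 0`, such a cluster forms the single ring of level `0`.
    simp only [h2, zero_div, Real.logb_zero, Int.floor_zero, le_refl, true_and]
    exact Int.floor_nonneg.2 (by linarith)
  · have hb : 0 < (ε / z) ^ 2 * Δ (σ i) := by positivity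
    have hq : 1 ≤ dist (P i) (A (σ i)) / ((ε / z) ^ 2 * Δ (σ i)) := (one_le_div hb).2 l
    refine ⟨Int.floor_nonneg.2 (Real.logb_nonneg (by norm_num) hq), Int.floor_le_floor ?_⟩
    rw [show (4 : ℝ) = (4 : ℕ) by norm_num, ← Real.logb_pow]
    refine Real.logb_le_logb_of_le (by norm_num) (zero_lt_one.trans_le hq) ?_
    rw [div_le_iff₀ hb]
    refine u.trans (le_of_eq ?_)
    field_simp

/-- Distances in a cluster of positive scale vary by a factor of at most `(z/ε)^4`. The dependence
on `log z` is absorbed into `2 ^ z`. -/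
theorem card_rings_le (hz : 1 ≤ z) (hε : 0 < ε) (hε' : ε < 1 / 3)
    (hΔ : ClustersInRange z ε P A σ Δ) :
    ((Finset.univ.image (ringIndex z ε σ (fun i c => dist (P i) (A c)) Δ)).card : ℝ) ≤
      m * (17 * 2 ^ z * Real.log (1 / ε)) := by
  set M := ⌊4 * Real.logb 2 (z / ε)⌋ with hM
  have hz1 : (1 : ℝ) ≤ z := by exact_mod_cast hz
  have hzε : 1 ≤ z / ε := (one_le_div hε).2 (by linarith)
  have hlog : 0 ≤ Real.logb 2 (z / ε) := Real.logb_nonneg (by norm_num) hzε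
  have hM0 : 0 ≤ M := Int.floor_nonneg.2 (by linarith)
  have hsub : Finset.univ.image (ringIndex z ε σ (fun i c => dist (P i) (A c)) Δ) ⊆
      (Finset.univ : Finset (Fin m)) ×ˢ Finset.Icc 0 M := by
    intro key hkey
    obtain ⟨i, -, rfl⟩ := Finset.mem_image.1 hkey
    exact Finset.mem_product.2 ⟨Finset.mem_univ _, ringIndex_snd_mem hz hε (by linarith) hΔ i⟩
  have hcard := Finset.card_le_card hsub
  rw [Finset.card_product, Finset.card_univ, Fintype.card_fin, Int.card_Icc, sub_zero] at hcard
  have h1 : (((M + 1).toNat : ℕ) : ℝ) = M + 1 := by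
    have : (((M + 1).toNat : ℤ) : ℝ) = ((M + 1 : ℤ) : ℝ) := by
      rw [Int.toNat_of_nonneg (by omega)]
    exact_mod_cast this
  have h2 : ((M + 1 : ℝ)) ≤ 17 * 2 ^ z * Real.log (1 / ε) := by
    have hL := one_le_log_one_div hε hε'
    have hfl : (M : ℝ) ≤ 4 * Real.logb 2 (z / ε) := Int.floor_le _
    have hpz : (z : ℝ) ≤ 2 ^ z := by exact_mod_cast Nat.lt_two_pow_self.le
    have hlogz : Real.log z ≤ 2 ^ z := by
      have := Real.log_le_sub_one_of_pos (zero_lt_one.trans_le hz1)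
      linarith
    have hp1 : (1 : ℝ) ≤ 2 ^ z := hz1.trans hpz
    set l := Real.log (1 / ε)
    have hl1 : (2 : ℝ) ^ z ≤ 2 ^ z * l := le_mul_of_one_le_right (by positivity) hL
    have hl2 : l ≤ 2 ^ z * l := le_mul_of_one_le_left (by linarith) hp1
    have h3 : Real.log (z / ε) ≤ 2 * (2 ^ z * l) := by
      rw [div_eq_mul_one_div, Real.log_mul (by positivity) (by positivity)]
      linarith
    have h4 : Real.logb 2 (z / ε) ≤ 4 * (2 ^ z * l) := by
      rw [Real.logb, div_le_iff₀ (Real.log_pos (by norm_num))]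
      have h5 := Real.log_two_gt_d9
      have h6 : 4 * (2 ^ z * l) * (1 / 2) ≤ 4 * (2 ^ z * l) * Real.log 2 :=
        mul_le_mul_of_nonneg_left (by linarith) (by linarith)
      linarith
    linarith
  calc _ ≤ ((m * (M + 1).toNat : ℕ) : ℝ) := by exact_mod_cast hcard
    _ = m * (M + 1) := by rw [Nat.cast_mul, h1]
    _ ≤ _ := mul_le_mul_of_nonneg_left h2 (Nat.cast_nonneg m)

/-- The `34` is `17` from the number of rings times `2` from rounding up `δ`. -/
theorem length_le_sizeBound {a k K N s r : ℕ} {π : ℝ} (hz : 1 ≤ z) (hε : 0 < ε)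
    (hε' : ε < 1 / 3) (hK : 2 ≤ K) (hm : m ≤ a * k) (hΔ : ClustersInRange z ε P A σ Δ)
    (hT : Real.log 2 ≤ entropyTerm k N π)
    (hs : s ≤ (Finset.univ.image (ringIndex z ε σ (fun i c => dist (P i) (A c)) Δ)).card *
      samplesPerRing K k z N ε π)
    (hr : 34 * K * a + K + 1 ≤ r) :
    (s : ℝ) ≤ sizeBound r k z N ε π := by
  have hL := one_le_log_one_div hε hε'
  have hT0 : 0 ≤ entropyTerm k N π := (Real.log_nonneg (by norm_num)).trans hT
  have h1 := card_rings_le hz hε hε' hΔ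
  have h2 := (samplesPerRing_le (z := z) hK hε hε' hT).2
  have hm' : (m : ℝ) ≤ a * k := by exact_mod_cast hm
  have hr1 : ((34 * K * a : ℕ) : ℝ) ≤ r := by
    exact_mod_cast (by omega : 34 * K * a ≤ r)
  have hr2 : (2 : ℝ) ^ (K * z + z) ≤ 2 ^ (r * z) := by
    refine pow_le_pow_right₀ (by norm_num) ?_
    calc K * z + z = (K + 1) * z := by ring
      _ ≤ r * z := Nat.mul_le_mul_right z (by omega)
  unfold sizeBound
  set l := Real.log (1 / ε)
  set T := entropyTerm k N π
  calc (s : ℝ) ≤ _ := Nat.cast_le.2 hs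
    _ = ((Finset.univ.image (ringIndex z ε σ (fun i c => dist (P i) (A c)) Δ)).card : ℝ) *
        samplesPerRing K k z N ε π := by push_cast; ring
    _ ≤ (m * (17 * 2 ^ z * l)) * (2 * (K * 2 ^ (K * z) * (l ^ 2 / ε ^ 2) * T)) := by
        gcongr
    _ ≤ ((a * k) * (17 * 2 ^ z * l)) * (2 * (K * 2 ^ (K * z) * (l ^ 2 / ε ^ 2) * T)) := by
        gcongr
    _ = (34 * K * a : ℕ) * (k * 2 ^ (K * z + z) * (l ^ 3 / ε ^ 2) * T) := by
        push_cast
        ring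
    _ ≤ r * (k * 2 ^ (r * z) * (l ^ 3 / ε ^ 2) * T) := by
        gcongr

/-! ### The error bound -/

theorem abs_totalCost_sub_weightedCost_le {k : ℕ} (hz : 1 ≤ z) (hε : 0 < ε) (hε' : ε < 1 / 3)
    (hσ : IsNearestAssignment P A σ) (hΔ : ClustersInRange z ε P A σ Δ)
    {ρ : Fin n → Fin m × ℤ} (hρ : ρ = ringIndex z ε σ (fun i c => dist (P i) (A c)) Δ)
    (S S' : Fin k → X)
    (hS : ∀ i, (cost z (P i) S ≤ (8 * z / ε) ^ z * cost z (P i) A ∨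
        cost z (P i) S' ≤ (8 * z / ε) ^ z * cost z (P i) A) →
      |cost z (P i) S - cost z (P i) S'| ≤
        ε / (z * Real.log (z / ε)) * (cost z (P i) S + cost z (P i) A))
    (L : List (Fin n × ℝ)) (hL : ∀ e ∈ L, 0 < e.2)
    (hmass : ∀ h : Fin m × ℤ → ℝ, weightedSum L (fun i => h (ρ i)) = ∑ i, h (ρ i))
    {M : Set (Fin m × ℤ)}
    (hM : M = {key | ∀ i, ρ i = key → cost z (P i) S' ≤ (8 * z / ε) ^ z * cost z (P i) A})
    {g : Fin n → ℝ} (hg0 : ∀ i, ρ i ∈ M → g i = cost z (P i) S') (hg1 : ∀ i, ρ i ∉ M → g i = 0)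
    (hg : |weightedSum L g - ∑ i, g i| ≤ ε * (∑ i, g i + ∑ i, cost z (P i) A))
    (hA : |weightedSum L (fun i => cost z (P i) A) - ∑ i, cost z (P i) A| ≤
      2 * ε * ∑ i, cost z (P i) A) :
    |totalCost z P S - weightedCost z P L S| ≤
      20 * ε * (totalCost z P S + totalCost z P A) := by
  have hS' : ∀ i, (cost z (P i) S ≤ (8 * z / ε) ^ z * cost z (P i) A ∨
        cost z (P i) S' ≤ (8 * z / ε) ^ z * cost z (P i) A) →
      |cost z (P i) S - cost z (P i) S'| ≤ ε * (cost z (P i) S + cost z (P i) A) :=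
    fun i hi => (hS i hi).trans (mul_le_mul_of_nonneg_right (precision_le hz hε hε')
      (add_nonneg (cost_nonneg _ _ _) (cost_nonneg _ _ _)))
  have hv : ∀ key, ∃ v : ℝ, (key ∈ M → v = 0) ∧ (key ∉ M → 0 ≤ v ∧
      ∀ i, ρ i = key → |cost z (P i) S - v| ≤ 2 * ε * v) := by
    intro key
    by_cases hkey : key ∈ M
    · exact ⟨0, fun _ => rfl, fun h => absurd hkey h⟩
    · have h1 := hkey
      rw [hM] at h1
      simp only [Set.mem_ofPred_eq, not_forall, not_le] at h1
      obtain ⟨i, rfl, hi⟩ := h1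
      refine ⟨cost z (P i) S, fun h => absurd h hkey, fun _ => ⟨cost_nonneg _ _ _, ?_⟩⟩
      intro i' hi'
      subst hρ
      exact exists_constant_of_far hz hε hε' hσ hΔ S S' (fun h => hS' i (Or.inl h)) hi hi'
  choose v hv0 hv1 using hv
  refine weightedSum_sub_sum_le ρ hε hε' L hL hmass (fun i => cost z (P i) S) g
    (fun i => cost z (P i) A) v (fun i => cost_nonneg _ _ _) (fun i => ?_) hg hA
  by_cases hi : ρ i ∈ M
  · left
    refine ⟨hg0 i hi ▸ cost_nonneg _ _ _, hv0 _ hi, ?_⟩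
    rw [hg0 i hi]
    refine hS' i (Or.inr ?_)
    rw [hM] at hi
    exact hi i rfl
  · exact Or.inr ⟨hg1 i hi, (hv1 _ hi).1, (hv1 _ hi).2 i rfl⟩

theorem coreset_error_bound {k K N : ℕ} {π : ℝ} {C : Finset X} (hN : N = C.card) (hK : 6 ≤ K)
    (hk : 1 ≤ k) (hz : 1 ≤ z) (hε : 0 < ε) (hε' : ε < 1 / 3) (hπ : 0 < π) (hπ' : π < 1)
    (hdeg : 2 ≤ k ∨ 2 ≤ N ∨ π ≤ 1 / 2) (hσ : IsNearestAssignment P A σ)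
    (hΔ : ClustersInRange z ε P A σ Δ) (hC : IsApproxCentroidSet k z ε P A C) :
    ENNReal.ofReal (1 - π) ≤ (coresetLaw K k z N ε π P A σ Δ).toOuterMeasure
      {r | ∀ S : Fin k → X, |totalCost z P S - weightedCost z P r.1 S| ≤
        20 * ε * (totalCost z P S + totalCost z P A)} := by
  classical
  have hT := log_two_le_entropyTerm hk hπ hπ' hdeg
  have hδ := (samplesPerRing_le (z := z) (by omega : 2 ≤ K) hε hε' hT).1
  have hcount := union_bound_le hk hπ hπ' hdeg (three_mul_entropyTerm_le (z := z) hK hε hε'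
    ((Real.log_nonneg (by norm_num)).trans hT))
  unfold coresetLaw
  set δ := samplesPerRing K k z N ε π
  set ρ := ringIndex z ε σ (fun i c => dist (P i) (A c)) Δ with hρ
  let M : (Fin k → C) → Set (Fin m × ℤ) := fun S' => {key | ∀ i, ρ i = key →
    cost z (P i) (fun j => (S' j : X)) ≤ (8 * z / ε) ^ z * cost z (P i) A}
  -- Nearness refers to `S'` alone, so finitely many functions serve all `S`. The index `none` adds
  -- the cost for `A`.
  let g : Option (Fin k → C) → Fin n → ℝ := fun o i => match o with
    | none => cost z (P i) A
    | some S' => if ρ i ∈ M S' then cost z (P i) (fun j => (S' j : X)) else 0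
  have hc : ∀ o, ∃ c : Fin m × ℤ → ℝ, (∀ i, |g o i| ≤ c (ρ i)) ∧
      ∀ i, c (ρ i) ≤ 8 ^ z * (g o i + cost z (P i) A) := by
    intro o
    refine exists_ring_bound ρ _ _ (fun i => ?_) fun i i' h => ?_
    · rcases o with _ | S'
      · exact cost_nonneg _ _ _
      · simp only [g]
        split_ifs
        · exact cost_nonneg _ _ _
        · exact le_rfl
    · rcases o with _ | S'
      · exact cost_le_of_ring hz hε hσ hΔ h A
      · simp only [g, h]
        split_ifs
        · exact cost_le_of_ring hz hε hσ hΔ h _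
        · exact mul_nonneg (by positivity) (add_nonneg le_rfl (cost_nonneg _ _ _))
  choose c hc1 hc2 using hc
  have hbound : ∀ o, ε / 8 ^ z * ∑ i, c o (ρ i) ≤
      ε * (∑ i, g o i + ∑ i, cost z (P i) A) := by
    intro o
    have h1 : ∑ i, c o (ρ i) ≤ 8 ^ z * (∑ i, g o i + ∑ i, cost z (P i) A) := by
      rw [← Finset.sum_add_distrib, Finset.mul_sum]
      exact Finset.sum_le_sum fun i _ => hc2 o i
    refine (mul_le_mul_of_nonneg_left h1 (by positivity)).trans (le_of_eq ?_)
    field_simp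
  have hprob := deviation_bound z ε σ (fun i c => dist (P i) (A c)) Δ hδ c g hc1
    (θ := ε / 8 ^ z) (π := π) (by positivity) hπ.le (by
      rw [Fintype.card_option, Fintype.card_fun, Fintype.card_coe, Fintype.card_fin, ← hN]
      push_cast
      exact hcount)
  refine hprob.trans (MeasureTheory.measure_mono ?_)
  rintro r ⟨hr, hdev⟩ S
  obtain ⟨S', hS'C, hS'⟩ := hC S
  obtain ⟨h1, -, h3, -⟩ := ringSampling_spec z ε σ _ Δ hδ hr
  have hdev' := fun o => (hdev o).trans (hbound o)
  have hA := hdev' none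
  rw [← two_mul, mul_left_comm, ← mul_assoc] at hA
  let Q : Fin k → C := fun j => ⟨S' j, hS'C j⟩
  exact abs_totalCost_sub_weightedCost_le hz hε hε' hσ hΔ hρ S S' hS' r.1 h1 h3
    (M := M Q) rfl (g := g (some Q)) (fun i hi => if_pos hi) (fun i hi => if_neg hi)
    (hdev' (some Q)) hA

end Rings

end RingCoreset

theorem mainTheorem8 :
    ∃ K₀ : ℕ, ∀ a : ℕ, ∃ K : ℕ, ∀ (X : Type*) [MetricSpace X] (n m k z : ℕ) (ε π : ℝ)
      (P : Fin n → X) (A : Fin m → X) (σ : Fin n → Fin m) (Δ : Fin m → ℝ) (C : Finset X),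
      1 ≤ k → 1 ≤ z → 0 < ε → ε < 1 / 3 → 0 < π → π < 1 →
      (2 ≤ k ∨ 2 ≤ C.card ∨ π ≤ 1 / 2) →
      m ≤ a * k →
      RingCoreset.IsNearestAssignment P A σ →
      RingCoreset.ClustersInRange z ε P A σ Δ →
      RingCoreset.IsApproxCentroidSet k z ε P A C →
      (∀ r ∈ (RingCoreset.coresetLaw K₀ k z C.card ε π P A σ Δ).support,
        r.2 ≤ K₀ * (n + 1) ∧
        (r.1.length : ℝ) ≤ RingCoreset.sizeBound K k z C.card ε π ∧
        ∀ e ∈ r.1, 0 < e.2) ∧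
      ENNReal.ofReal (1 - π) ≤
        (RingCoreset.coresetLaw K₀ k z C.card ε π P A σ Δ).toOuterMeasure {r |
          (∀ S : Fin k → X,
            |RingCoreset.totalCost z P S - RingCoreset.weightedCost z P r.1 S| ≤
              K₀ * ε * (RingCoreset.totalCost z P S + RingCoreset.totalCost z P A)) ∧
          (∀ α : ℝ, RingCoreset.IsApproxSolution k z α P A → ∀ S : Fin k → X,
            |RingCoreset.totalCost z P S - RingCoreset.weightedCost z P r.1 S| ≤
              K₀ * (1 + α) * ε * RingCoreset.totalCost z P S)} := by
  -- The value `23` covers the step count `23 n + 3`, the error constant `20` and the condition `6 ≤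
  -- K`.
  refine ⟨23, fun a => ⟨34 * 23 * a + 23 + 1, ?_⟩⟩
  intro X _ n m k z ε π P A σ Δ C hk hz hε hε' hπ hπ' hdeg hm hσ hΔ hC
  have hT := RingCoreset.log_two_le_entropyTerm hk hπ hπ' hdeg
  have hδ := (RingCoreset.samplesPerRing_le (K := 23) (z := z) (by norm_num) hε hε' hT).1
  refine ⟨fun r hr => ?_, ?_⟩
  · obtain ⟨h1, h2, -, h4⟩ := RingCoreset.ringSampling_spec z ε σ _ Δ hδ hr
    exact ⟨by omega, RingCoreset.length_le_sizeBound hz hε hε' (by norm_num) hm hΔ hT h2 le_rfl,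
      h1⟩
  · refine (RingCoreset.coreset_error_bound (K := 23) rfl (by norm_num) hk hz hε hε' hπ hπ' hdeg
      hσ hΔ hC).trans (MeasureTheory.measure_mono fun r hr => ?_)
    have h0 : ∀ {l : ℕ} (S : Fin l → X), 0 ≤ RingCoreset.totalCost z P S := fun S =>
      Finset.sum_nonneg fun i _ => RingCoreset.cost_nonneg _ _ _
    have h1 : ∀ S : Fin k → X,
        |RingCoreset.totalCost z P S - RingCoreset.weightedCost z P r.1 S| ≤
          (23 : ℕ) * ε * (RingCoreset.totalCost z P S + RingCoreset.totalCost z P A) := by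
      intro S
      refine (hr S).trans (mul_le_mul_of_nonneg_right ?_ (add_nonneg (h0 S) (h0 A)))
      push_cast
      linarith
    refine ⟨h1, fun α hα S => (h1 S).trans ?_⟩
    have h2 := hα S
    calc (23 : ℕ) * ε * (RingCoreset.totalCost z P S + RingCoreset.totalCost z P A)
        ≤ (23 : ℕ) * ε * ((1 + α) * RingCoreset.totalCost z P S) := by
          refine mul_le_mul_of_nonneg_left ?_ (by positivity)
          linarith
      _ = _ := by ring
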